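/- **Notation.** Let $\Lambda=\mathbb{C}[t_1,t_2,\dots]$ and set $t_k=0$, $\partial/\partial t_k=0$ for $k\le 0$. For $n\ge 2$ and $m\in\mathbb{Z}$ define the operator on $\Lambda$ $$L_m^{(n)}=\sum_{k\ge1,\ n\nmid k}k\,t_k\frac{\partial}{\partial t_{k+nm}}+\frac12\sum_{\substack{1\le k\le mn-1\\ n\nmid k}}\frac{\partial^2}{\partial t_k\,\partial t_{mn-k}}-\frac12\sum_{\substack{1\le k\le -mn-1\\ n\nmid k}}k(mn+k)\,t_k\,t_{-mn-k}+\delta_{m,0}\frac{n^2-1}{24}.$$ For a parameter $\rho$ let $B_a$ ($a\in\mathbb{Z}$) be the operators with generating function $$\sum_{a\in\mathbb{Z}}B_a u^a=\exp\Big(\sum_{r\ge1}(1-\rho^r)\,t_r u^r\Big)\exp\Big(-\sum_{r\ge1}\frac{u^{-r}}{r}\frac{\partial}{\partial t_r}\Big),$$ and for $\lambda=(\lambda_1,\dots,\lambda_l)\in\mathbb{Z}^l$ let $Q_\lambda(\mathbf t;\rho)=B_{\lambda_1}\cdots B_{\lambda_l}\cdot 1$ be the Hall-Littlewood polynomial.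 Let $\xi_n$ be a primitive $n$-th root of unity and $Q^{(n)}_\lambda=Q_\lambda(\mathbf t;\xi_n)$. Write $\epsilon_i$ for the $i$-th standard basis vector and $(\lambda,\mu)$ for concatenation of vectors. Let $\mathcal P$ be the set of partitions $\mu=(\mu_1\ge\dots\ge\mu_{l(\mu)}>0)$ and $|\mu|=\sum_i\mu_i$. For a nonempty $\mu\in\mathcal P$ let $c_\mu$ be the rational function $$c_\mu(\rho)=\frac{\rho^{n(\mu)}\,\phi_{l(\mu)-1}(\rho^{-1})}{b_\mu(\rho)},\qquad n(\mu)=\sum_{i}(i-1)\mu_i,\quad \phi_k(x)=\prod_{i=1}^k(1-x^i),\quad b_\mu(\rho)=\prod_{i\ge1}\phi_{m_i(\mu)}(\rho),$$ where $m_i(\mu)$ is the number of $j$ with $\mu_j=i$; $c_\mu(\xi_n)$ is the value at $\rho=\xi_n$ of this rational function in reduced form (it has no pole there when $n\nmid|\mu|$). **Theorem 1.2.** For all $n\ge2$, $m\ge1$ and $\lambda\in\mathbb{Z}^l$, $$\begin{aligned}L_{-m}^{(n)}Q^{(n)}_\lambda={}&\sum_{i=1}^l\Big(\lambda_i+\frac{m(n-1)}2\Big)Q^{(n)}_{\lambda+mn\epsilon_i}+\sum_{\substack{1\le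 k\le mn-1\\ n\nmid k}}\ \sum_{\substack{1\le i,j\le l\\ i>j}}\xi_n^k\,Q^{(n)}_{\lambda+k\epsilon_i+(mn-k)\epsilon_j}\\ &+\sum_{i=1}^l\ \sum_{\substack{1\le k\le mn-1\\ n\nmid k}}\xi_n^k\sum_{\substack{\mu\in\mathcal P\\|\mu|=k}}c_\mu(\xi_n)\,Q^{(n)}_{(\lambda+(mn-k)\epsilon_i,\ \mu)}\\ &+\frac12\sum_{\substack{1\le k\le mn-1\\ n\nmid k}}\Big(\sum_{\substack{\mu\in\mathcal P\\|\mu|=k}}\ \sum_{j=1}^{l(\mu)}c_\mu(\xi_n)\,Q^{(n)}_{(\lambda,\ \mu+(mn-k)\epsilon_j)}+\sum_{\substack{\mu,\nu\in\mathcal P\\|\mu|=k,\ |\nu|=mn-k}}c_\mu(\xi_n)\,c_\nu(\xi_n)\,Q^{(n)}_{(\lambda,\mu,\nu)}\Big).\end{aligned}$$ -/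

import Mathlib

noncomputable section

namespace HallLittlewood

open Finset

/-- The ring of polynomials in the variables `t_1, t_2, t_3, …` over `K`. -/
abbrev Lam (K : Type*) [CommRing K] : Type _ := MvPolynomial ℕ+ K

/-- The exponential `∑_k a ^ k / k!` of a formal power series `a` with zero constant term, over a
ring that need not be commutative. Since `a ^ k` has no terms of degree below `k`, only `k ≤ j`
contribute to the coefficient of degree `j`. -/
def expSeries {A : Type*} [Ring A] [Algebra ℚ A] (a : PowerSeries A) : PowerSeries A :=
  PowerSeries.mk fun j =>
    ∑ k ∈ range (j + 1), (1 / (k.factorial : ℚ)) • PowerSeries.coeff j (a ^ k)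

section General

variable {K : Type*} [CommRing K] [Algebra ℚ K]

/-- The variable `t_k` for `k ≥ 1`, and `0` for `k ≤ 0`. -/
def tvar (K : Type*) [CommRing K] (k : ℤ) : Lam K :=
  if 0 < k then MvPolynomial.X k.toNat.toPNat' else 0

/-- The operator `∂/∂t_k` for `k ≥ 1`, and `0` for `k ≤ 0`. -/
def dt (K : Type*) [CommRing K] (k : ℤ) : Module.End K (Lam K) :=
  if 0 < k then (MvPolynomial.pderiv k.toNat.toPNat').toLinearMap else 0

/-- The series `exp (∑_{r ≥ 1} (1 - ρ ^ r) t_r u ^ r)` in `u`. -/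
def creation (ρ : K) : PowerSeries (Lam K) :=
  expSeries (PowerSeries.mk fun r => (1 - ρ ^ r) • tvar K r)

/-- The series `exp (- ∑_{r ≥ 1} (1 - ρ ^ r) t_r^⊥ v ^ r)` in `v = u⁻¹`, whose coefficients are
differential operators. Here `t_r^⊥ = (r (1 - ρ ^ r))⁻¹ ∂/∂t_r` is the adjoint of the multiplication
by `t_r`, so that `(1 - ρ ^ r) t_r^⊥ = r⁻¹ ∂/∂t_r`, which makes sense for every `ρ`. -/
def annihilation (K : Type*) [CommRing K] [Algebra ℚ K] : PowerSeries (Module.End K (Lam K)) :=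
  expSeries (PowerSeries.mk fun r => -((1 / (r : ℚ)) • dt K r))

/-- The operator `B_m`, `m ∈ ℤ`: the coefficient of `u ^ m` in the vertex operator
`B(u) = exp (∑ (1 - ρ ^ r) t_r u ^ r) exp (- ∑ (1 - ρ ^ r) t_r^⊥ u ^ (-r))`. On each polynomial
only finitely many terms of the sum are nonzero (`finite_vertexOp` below). -/
def vertexOp (ρ : K) (m : ℤ) (f : Lam K) : Lam K :=
  ∑ᶠ j : ℕ, if 0 ≤ m + j then
    PowerSeries.coeff (m + j).toNat (creation ρ) * (PowerSeries.coeff j (annihilation K)) f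
  else 0

/-- The Hall-Littlewood polynomial `Q_λ(t; ρ) = B_{λ_1} ⋯ B_{λ_l} · 1` of `λ ∈ ℤ^l`. -/
def Q (ρ : K) {l : ℕ} (lam : Fin l → ℤ) : Lam K :=
  (List.ofFn lam).foldr (vertexOp ρ) 1

end General

/-! ### Finiteness of the sum that defines `vertexOp` -/

section Finiteness

variable {K : Type*} [CommRing K]

/-- `T` lowers the degree by `j` for the grading `deg t_r = r`. -/
def Lowers (j : ℕ) (T : Module.End K (Lam K)) : Prop :=
  ∀ (d : ℕ) (f : Lam K), f.IsWeightedHomogeneous (fun r : ℕ+ => (r : ℕ)) d →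
    (d < j → T f = 0) ∧ (j ≤ d → (T f).IsWeightedHomogeneous (fun r : ℕ+ => (r : ℕ)) (d - j))

theorem Lowers.zero (j : ℕ) : Lowers j (0 : Module.End K (Lam K)) :=
  fun _ _ _ => ⟨fun _ => rfl, fun _ => MvPolynomial.isWeightedHomogeneous_zero _ _ _⟩

theorem Lowers.one : Lowers 0 (1 : Module.End K (Lam K)) :=
  fun _ _ h => ⟨fun h0 => absurd h0 (Nat.not_lt_zero _), fun _ => h⟩

theorem Lowers.add {j : ℕ} {S T : Module.End K (Lam K)} (hS : Lowers j S) (hT : Lowers j T) :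
    Lowers j (S + T) := fun d f hf =>
  ⟨fun h => by simp [(hS d f hf).1 h, (hT d f hf).1 h],
    fun h => ((hS d f hf).2 h).add ((hT d f hf).2 h)⟩

theorem Lowers.sum {ι : Type*} {j : ℕ} (s : Finset ι) (T : ι → Module.End K (Lam K))
    (h : ∀ i ∈ s, Lowers j (T i)) : Lowers j (∑ i ∈ s, T i) :=
  Finset.sum_induction T (Lowers j) (fun _ _ => Lowers.add) (Lowers.zero j) h

theorem Lowers.smul [Algebra ℚ K] {j : ℕ} {T : Module.End K (Lam K)} (c : ℚ) (hT : Lowers j T) :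
    Lowers j (c • T) := fun d f hf =>
  ⟨fun h => by simp [(hT d f hf).1 h],
    fun h => by
      have := (MvPolynomial.weightedHomogeneousSubmodule K (fun r : ℕ+ => (r : ℕ))
        (d - j)).smul_mem (algebraMap ℚ K c) ((hT d f hf).2 h)
      rw [algebraMap_smul] at this
      exact this⟩

theorem Lowers.mul {i j : ℕ} {S T : Module.End K (Lam K)} (hS : Lowers i S) (hT : Lowers j T) :
    Lowers (i + j) (S * T) := by
  intro d f hf
  rw [Module.End.mul_apply]
  by_cases hd : d < j
  · rw [(hT d f hf).1 hd, map_zero]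
    exact ⟨fun _ => rfl, fun _ => MvPolynomial.isWeightedHomogeneous_zero _ _ _⟩
  · have h1 := hS _ _ ((hT d f hf).2 (by omega))
    refine ⟨fun h => h1.1 (by omega), fun h => ?_⟩
    have := h1.2 (by omega)
    rwa [show d - (i + j) = d - j - i by omega]

theorem dt_apply_of_pos (r : ℕ+) (f : Lam K) : dt K r f = MvPolynomial.pderiv r f := by
  simp [dt]

theorem dt_of_nonpos {k : ℤ} (hk : k ≤ 0) : dt K k = 0 := if_neg (not_lt.mpr hk)

theorem Lowers.dt (r : ℕ) : Lowers r (dt K r) := by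
  rcases Nat.eq_zero_or_pos r with rfl | hr
  · rw [dt_of_nonpos (by simp)]
    exact Lowers.zero _
  · lift r to ℕ+ using hr
    intro d f hf
    rw [dt_apply_of_pos]
    have key : ∀ c : ℕ+ →₀ ℕ, MvPolynomial.coeff c (MvPolynomial.pderiv r f) ≠ 0 →
        Finsupp.weight (fun r : ℕ+ => (r : ℕ)) c + r = d := by
      intro c hc
      rw [MvPolynomial.coeff_pderiv] at hc
      have := hf (left_ne_zero_of_mul hc)
      rw [map_add, Finsupp.weight_single] at this
      simpa using this
    refine ⟨fun hlt => ?_, fun hle c hc => ?_⟩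
    · ext c
      by_contra hc
      have := key c (by simpa using hc)
      omega
    · have := key c hc
      omega

theorem lowers_annihilation [Algebra ℚ K] (j : ℕ) :
    Lowers j (PowerSeries.coeff j (annihilation K)) := by
  rw [annihilation, expSeries, PowerSeries.coeff_mk]
  refine Lowers.sum _ _ fun k hk => Lowers.smul _ ?_
  clear hk
  generalize hA : (PowerSeries.mk fun r : ℕ => -((1 / (r : ℚ)) • HallLittlewood.dt K r)) = a
  have ha : ∀ r, Lowers r (PowerSeries.coeff r a) := fun r => by
    have h := Lowers.smul (-1) (Lowers.smul (1 / (r : ℚ)) (Lowers.dt (K := K) r))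
    rw [← hA, PowerSeries.coeff_mk]
    intro d f hf
    simpa using h d f hf
  clear hA
  induction k generalizing j with
  | zero =>
    rw [pow_zero, PowerSeries.coeff_one]
    split_ifs with h
    · rw [h]; exact Lowers.one
    · exact Lowers.zero _
  | succ k ih =>
    rw [pow_succ, PowerSeries.coeff_mul]
    refine Lowers.sum _ _ fun p hp => ?_
    rw [← mem_antidiagonal.mp hp]
    exact Lowers.mul (ih p.1) (ha p.2)

theorem finite_annihilation [Algebra ℚ K] (f : Lam K) :
    {j : ℕ | (PowerSeries.coeff j (annihilation K)) f ≠ 0}.Finite := by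
  induction f using MvPolynomial.induction_on' with
  | monomial u a =>
    refine (Set.finite_Iic (Finsupp.weight (fun r : ℕ+ => (r : ℕ)) u)).subset fun j hj => ?_
    by_contra hlt
    exact hj ((lowers_annihilation j _ _
      (MvPolynomial.isWeightedHomogeneous_monomial _ u a rfl)).1 (not_le.mp hlt))
  | add p q hp hq =>
    refine (hp.union hq).subset fun j hj => ?_
    by_contra hc
    simp only [Set.mem_union, Set.mem_ofPred_eq, not_or, not_not] at hc
    exact hj (by rw [map_add, hc.1, hc.2, add_zero])

theorem finite_vertexOp [Algebra ℚ K] (ρ : K) (m : ℤ) (f : Lam K) :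
    (Function.support fun j : ℕ => if 0 ≤ m + j then
      PowerSeries.coeff (m + j).toNat (creation ρ) * (PowerSeries.coeff j (annihilation K)) f
    else 0).Finite := by
  refine (finite_annihilation f).subset fun j hj h0 => hj ?_
  simp only [h0, mul_zero, ite_self]

end Finiteness

/-! ### The Virasoro operators -/

/-- The operator `L_m^{(n)}`, `m ∈ ℤ`, with the conventions `t_k = 0` and `∂/∂t_k = 0` for `k ≤ 0`.
The first sum is over all `k ≥ 1` with `n ∤ k`; on each polynomial only finitely many of its terms
are nonzero (`finite_virasoro` below). -/
def virasoro (n : ℕ) (m : ℤ) (f : Lam ℂ) : Lam ℂ :=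
  (∑ᶠ k : ℕ, if 1 ≤ k ∧ ¬ n ∣ k then (k : ℂ) • (tvar ℂ k * dt ℂ (k + n * m) f) else 0)
  + (1 / 2 : ℂ) • ∑ k ∈ (Icc (1 : ℤ) (m * n - 1)).filter (fun k => ¬ (n : ℤ) ∣ k),
      dt ℂ k (dt ℂ (m * n - k) f)
  - (1 / 2 : ℂ) • ∑ k ∈ (Icc (1 : ℤ) (-m * n - 1)).filter (fun k => ¬ (n : ℤ) ∣ k),
      ((k : ℂ) * ((m : ℂ) * n + k)) • (tvar ℂ k * tvar ℂ (-m * n - k) * f)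
  + (if m = 0 then ((n : ℂ) ^ 2 - 1) / 24 else 0) • f

theorem finite_virasoro (n : ℕ) (m : ℤ) (f : Lam ℂ) :
    (Function.support fun k : ℕ => if 1 ≤ k ∧ ¬ n ∣ k then
      (k : ℂ) • (tvar ℂ k * dt ℂ (k + n * m) f) else 0).Finite := by
  have h1 : ((fun k : ℕ => (k : ℤ) + n * m) ⁻¹' ((fun r : ℕ+ => ((r : ℕ) : ℤ)) '' f.vars)).Finite :=
    Set.Finite.preimage (fun a _ b _ h => by simpa using h) (f.vars.finite_toSet.image _)
  refine h1.subset fun k hk => ?_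
  by_contra hc
  refine hk ?_
  have h0 : dt ℂ (k + n * m) f = 0 := by
    rcases le_or_gt ((k : ℤ) + n * m) 0 with h | h
    · rw [dt_of_nonpos h, LinearMap.zero_apply]
    · obtain ⟨r, hr⟩ : ∃ r : ℕ+, ((r : ℕ) : ℤ) = k + n * m :=
        ⟨((k : ℤ) + n * m).toNat.toPNat', by rw [Nat.toPNat'_coe]; split_ifs <;> omega⟩
      rw [← hr, dt_apply_of_pos]
      exact MvPolynomial.pderiv_eq_zero_of_notMem_vars fun hv => hc ⟨r, hv, hr⟩
  simp only [h0, mul_zero, smul_zero, ite_self]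

/-! ### Partitions and the coefficients `c_μ` -/

/-- The parts of a partition in weakly decreasing order. -/
def partsList {k : ℕ} (μ : Nat.Partition k) : List ℕ := μ.parts.sort (· ≥ ·)

/-- The length `l(μ)`, the number of parts. -/
def len {k : ℕ} (μ : Nat.Partition k) : ℕ := (partsList μ).length

/-- A partition `μ = (μ_1 ≥ μ_2 ≥ ⋯ ≥ μ_{l(μ)} > 0)` as a vector of integers. -/
def vec {k : ℕ} (μ : Nat.Partition k) : Fin (len μ) → ℤ := fun i => ((partsList μ).get i : ℤ)

/-- `φ_k(x) = ∏_{i=1}^k (1 - x ^ i)`. -/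
def phi {F : Type*} [Field F] (k : ℕ) (x : F) : F := ∏ i ∈ Icc 1 k, (1 - x ^ i)

/-- `n(μ) = ∑_i (i - 1) μ_i`; the index `i : Fin (len μ)` starts from `0`. -/
def nStat {k : ℕ} (μ : Nat.Partition k) : ℕ := ∑ i : Fin (len μ), (i : ℕ) * (partsList μ).get i

/-- `b_μ(x) = ∏_{i ≥ 1} φ_{m_i(μ)}(x)` with `m_i(μ)` the multiplicity of `i` in `μ`; the factors
with `m_i(μ) = 0` are `1`. -/
def bFactor {F : Type*} [Field F] {k : ℕ} (μ : Nat.Partition k) (x : F) : F :=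
  ∏ i ∈ μ.parts.toFinset, phi (μ.parts.count i) x

/-- The rational function `c_μ(ρ) = ρ ^ n(μ) φ_{l(μ)-1}(ρ⁻¹) / b_μ(ρ)` of the variable `ρ`, for a
nonempty partition `μ`. -/
def cRat {k : ℕ} (μ : Nat.Partition k) : RatFunc ℂ :=
  RatFunc.X ^ nStat μ * phi (len μ - 1) (RatFunc.X : RatFunc ℂ)⁻¹ /
    bFactor μ (RatFunc.X : RatFunc ℂ)

/-- The value `c_μ(ξ)` at `ξ ∈ ℂ` of the rational function `c_μ`, that is of its reduced fraction.
(At an `n`-th root of unity `c_μ` has no pole if `n ∤ |μ|`, but its numerator and its denominator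
as they are written above may both vanish.) -/
def c {k : ℕ} (μ : Nat.Partition k) (ξ : ℂ) : ℂ := RatFunc.eval (RingHom.id ℂ) ξ (cRat μ)

/-- The indices `1 ≤ k ≤ N - 1` with `n ∤ k`. -/
def idx (n N : ℕ) : Finset ℕ := (Icc 1 (N - 1)).filter fun k => ¬ n ∣ k

end HallLittlewood

end

/-!
Write `p_k = k t_k`, `N = m n` and `B_a` for `vertexOp ξ a`. Apart from a sum over `k` of
`p_k ∂/∂t_{k-N}`, the operator `L_{-m}` is the multiplication by `½ ∑ p_k p_{N-k}`. From
`[p_k, B_a] = B_{a+k}` and Newton's recursion for the coefficients `q_a = B_a · 1` one obtains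
(`virL_bop`), on the polynomials in the `t_k` with `n ∤ k`,
`[L_{-m}, B_a] = (a + m (n - 1) / 2) B_{a+N} + ∑_k ξ ^ k B_{a+N-k} p_k`, where `k` runs through the
indices `1 ≤ k < N` with `n ∤ k`; the relation `ξ ^ n = 1` is what makes the infinite sums on both
sides agree. Moving `L_{-m}` and then the `p_k` to the right through `B_{λ_1} ⋯ B_{λ_l}`
(`virL_bvec`, `psum_mul_bvec`) gives the four groups of terms of the theorem, once the vectors
`p_k · 1` are expanded in Hall-Littlewood polynomials: `p_k = ∑_{|μ| = k} c_μ(ξ) Q_μ`.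

This expansion (`smul_X_eq_sum_qList`) is proved first for a parameter `ρ` that is not a root of
unity. The adjoint `C_a` of `B_a` for the Hall-Littlewood inner product is again a vertex operator,
and the two families satisfy a quadratic relation (`cop_bop_relation`). It implies that the
functional `f ↦` constant term of `C_{ν_l} ⋯ C_{ν_1} f` takes the value `b_μ` at `Q_μ` if `ν = μ`, and
`0` for other partitions (`pairQ_partsList`). So the `Q_μ` with `|μ| = k` are linearly independent,
and they span the polynomials of weight `k` because there are as many of them as monomials. The
coefficient of `Q_ν` in `p_k` is then found by applying the functional to `p_k`, which is a telescoping
computation: each `C_b` turns `exp (-∑ (1 - σ ^ r) t_r u ^ r)` into the same series with `ρ σ` in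
place of `σ`, up to a factor (`cop_qneg`).

At `ρ = ξ` with `n ∤ k` the functions `c_μ` have no pole: the order of the zero of `φ_s` at `ξ` is
`⌊s / n⌋`, and `∑_i ⌊m_i(μ) / n⌋ ≤ ⌊(l(μ) - 1) / n⌋` unless `n` divides all the multiplicities, hence `k`.
As the coefficients of `Q_μ` are polynomials in `ρ`, the expansion at `ξ` is the limit of the
expansions nearby (`smul_tvar_eq_sum_qList`).
-/

noncomputable section

namespace HallLittlewood

open Finset

/-! ### Exponentials of formal power series -/

section NonComm

variable {A : Type*} [Ring A]

theorem commute_of_coeff {a b : PowerSeries A}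
    (h : ∀ r s, Commute (PowerSeries.coeff r a) (PowerSeries.coeff s b)) : Commute a b := by
  refine PowerSeries.ext fun j => ?_
  rw [PowerSeries.coeff_mul, PowerSeries.coeff_mul, ← Finset.Nat.sum_antidiagonal_swap]
  exact sum_congr rfl fun p _ => (h _ _).eq

theorem coeff_pow_of_lt {a : PowerSeries A} (h : PowerSeries.coeff 0 a = 0) {j k : ℕ}
    (hjk : j < k) : PowerSeries.coeff j (a ^ k) = 0 := by
  induction k generalizing j with
  | zero => omega
  | succ k ih =>
    rw [pow_succ, PowerSeries.coeff_mul]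
    refine sum_eq_zero fun p hp => ?_
    rw [HasAntidiagonal.mem_antidiagonal] at hp
    rcases Nat.eq_zero_or_pos p.2 with h2 | h2
    · rw [h2, h, mul_zero]
    · rw [ih (by omega), zero_mul]

end NonComm

section Euler

variable {A : Type*} [Ring A] [Algebra ℚ A]

/-- The Euler derivation `u d/du` of formal power series over a ring that need not be
commutative. -/
def euler (f : PowerSeries A) : PowerSeries A :=
  PowerSeries.mk fun j => (j : ℚ) • PowerSeries.coeff j f

theorem coeff_euler (f : PowerSeries A) (j : ℕ) :
    PowerSeries.coeff j (euler f) = (j : ℚ) • PowerSeries.coeff j f := PowerSeries.coeff_mk _ _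

theorem euler_add (f g : PowerSeries A) : euler (f + g) = euler f + euler g := by
  ext j; simp [coeff_euler]

theorem coeff_smul_rat (c : ℚ) (f : PowerSeries A) (j : ℕ) :
    PowerSeries.coeff j (c • f) = c • PowerSeries.coeff j f := rfl

theorem euler_smul_rat (c : ℚ) (f : PowerSeries A) : euler (c • f) = c • euler f := by
  ext j
  rw [coeff_euler, coeff_smul_rat, coeff_smul_rat, coeff_euler, smul_comm]

theorem euler_mul (f g : PowerSeries A) : euler (f * g) = euler f * g + f * euler g := by
  ext j
  simp only [coeff_euler, PowerSeries.coeff_mul, map_add, Finset.smul_sum, ← sum_add_distrib]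
  refine sum_congr rfl fun p hp => ?_
  rw [smul_mul_assoc, mul_smul_comm, ← add_smul, ← HasAntidiagonal.mem_antidiagonal.mp hp]
  push_cast; rfl

theorem euler_one : euler (1 : PowerSeries A) = 0 := by
  ext j
  rw [coeff_euler, PowerSeries.coeff_one]
  split_ifs with h <;> simp [h]

theorem euler_pow_succ {a : PowerSeries A} (h : Commute a (euler a)) (k : ℕ) :
    euler (a ^ (k + 1)) = ((k + 1 : ℕ) : ℚ) • (euler a * a ^ k) := by
  induction k with
  | zero => simp
  | succ k ih =>
    rw [pow_succ, euler_mul, ih, smul_mul_assoc, mul_assoc, ← pow_succ, (h.pow_left (k + 1)).eq,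
      Nat.cast_succ (k + 1), add_smul, one_smul]

theorem coeff_zero_expSeries (a : PowerSeries A) : PowerSeries.coeff 0 (expSeries a) = 1 := by
  simp [expSeries]

/-- The differential equation of the exponential; in coefficients it is Newton's recursion. -/
theorem euler_expSeries {a : PowerSeries A} (h0 : PowerSeries.coeff 0 a = 0)
    (h : ∀ r s, Commute (PowerSeries.coeff r a) (PowerSeries.coeff s a)) :
    euler (expSeries a) = euler a * expSeries a := by
  have hc : Commute a (euler a) := commute_of_coeff fun r s => by
    rw [coeff_euler]; exact (h r s).smul_right _
  ext j
  have e1 : PowerSeries.coeff j (euler (expSeries a)) =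
      ∑ k ∈ range j, (1 / (k.factorial : ℚ)) • PowerSeries.coeff j (euler a * a ^ k) := by
    rw [coeff_euler, expSeries, PowerSeries.coeff_mk, sum_range_succ', smul_add, Finset.smul_sum]
    have : (j : ℚ) • (1 / ((Nat.factorial 0 : ℕ) : ℚ)) • PowerSeries.coeff j (a ^ 0) = 0 := by
      rw [pow_zero, PowerSeries.coeff_one]
      split_ifs with h <;> simp [h]
    rw [this, add_zero]
    refine sum_congr rfl fun k _ => ?_
    rw [smul_comm, ← coeff_euler, euler_pow_succ hc, coeff_smul_rat, smul_smul]
    congr 1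
    rw [Nat.factorial_succ]
    have : (k.factorial : ℚ) ≠ 0 := by positivity
    push_cast
    field_simp
  rw [e1, PowerSeries.coeff_mul]
  simp only [PowerSeries.coeff_mul, Finset.smul_sum]
  rw [sum_comm]
  refine sum_congr rfl fun p hp => ?_
  rw [HasAntidiagonal.mem_antidiagonal] at hp
  rcases Nat.eq_zero_or_pos p.1 with h1 | h1
  · simp [h1, coeff_euler]
  · rw [expSeries, PowerSeries.coeff_mk, mul_sum]
    have hsub : range (p.2 + 1) ⊆ range j := range_subset_range.mpr (by omega)
    refine (sum_subset hsub fun k _ hk => ?_).symm.trans ?_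
    · rw [coeff_pow_of_lt h0 (by simpa using hk), mul_zero, smul_zero]
    · exact sum_congr rfl fun k _ => (mul_smul_comm _ _ _).symm

/-- A series is determined by its constant term and its logarithmic derivative. -/
theorem eq_of_euler {b f g : PowerSeries A} (hb : PowerSeries.coeff 0 b = 0)
    (h0 : PowerSeries.coeff 0 f = PowerSeries.coeff 0 g) (hf : euler f = b * f)
    (hg : euler g = b * g) : f = g := by
  ext j
  induction j using Nat.strong_induction_on with
  | _ j ih =>
    rcases Nat.eq_zero_or_pos j with rfl | hj
    · exact h0
    · have key : (j : ℚ) • PowerSeries.coeff j f = (j : ℚ) • PowerSeries.coeff j g := by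
        rw [← coeff_euler, ← coeff_euler, hf, hg, PowerSeries.coeff_mul, PowerSeries.coeff_mul]
        refine sum_congr rfl fun p hp => ?_
        rw [HasAntidiagonal.mem_antidiagonal] at hp
        rcases Nat.eq_zero_or_pos p.1 with h1 | h1
        · rw [h1, hb, zero_mul, zero_mul]
        · rw [ih p.2 (by omega)]
      have hj' : (j : ℚ) ≠ 0 := by positivity
      simpa [smul_smul, hj'] using congrArg (fun x => (j : ℚ)⁻¹ • x) key

theorem expSeries_map {A' : Type*} [Ring A'] [Algebra ℚ A'] (φ : A →+* A') (a : PowerSeries A) :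
    PowerSeries.map φ (expSeries a) = expSeries (PowerSeries.map φ a) := by
  ext j
  simp only [expSeries, PowerSeries.coeff_map, PowerSeries.coeff_mk, map_sum, map_rat_smul,
    ← map_pow]

end Euler

section EulerComm

variable {A : Type*} [CommRing A] [Algebra ℚ A]

theorem eq_expSeries {a f : PowerSeries A} (h0 : PowerSeries.coeff 0 a = 0)
    (hf0 : PowerSeries.coeff 0 f = 1) (hf : euler f = euler a * f) : f = expSeries a :=
  eq_of_euler (by simp [coeff_euler]) (hf0.trans (coeff_zero_expSeries a).symm) hf
    (euler_expSeries h0 fun _ _ => Commute.all _ _)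

theorem expSeries_add {a b : PowerSeries A} (ha : PowerSeries.coeff 0 a = 0)
    (hb : PowerSeries.coeff 0 b = 0) : expSeries (a + b) = expSeries a * expSeries b := by
  refine (eq_expSeries (by rw [map_add, ha, hb, add_zero]) ?_ ?_).symm
  · simp [PowerSeries.coeff_mul, coeff_zero_expSeries]
  · rw [euler_mul, euler_add, euler_expSeries ha fun _ _ => Commute.all _ _,
      euler_expSeries hb fun _ _ => Commute.all _ _]
    ring

theorem expSeries_zero : expSeries (0 : PowerSeries A) = 1 :=
  (eq_expSeries (by simp) (by simp) (by rw [euler_one]; ext; simp [coeff_euler])).symm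

theorem expSeries_rescale (x : A) (a : PowerSeries A) :
    PowerSeries.rescale x (expSeries a) = expSeries (PowerSeries.rescale x a) := by
  ext j
  simp only [expSeries, PowerSeries.coeff_rescale, PowerSeries.coeff_mk, mul_sum, ← map_pow,
    mul_smul_comm]

/-- `exp (∑_{r ≥ 1} (y ^ r - x ^ r) w ^ r / r) = (1 - x w) / (1 - y w)`. -/
theorem expSeries_log (x y : A) :
    expSeries (PowerSeries.mk fun r => (1 / (r : ℚ)) • (y ^ r - x ^ r)) =
      (1 - PowerSeries.C x * PowerSeries.X) * PowerSeries.mk fun k => y ^ k := by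
  have geom : ∀ z : A, (1 - PowerSeries.C z * PowerSeries.X) * (PowerSeries.mk fun k => z ^ k) = 1 := by
    intro z
    ext j
    rcases j with _ | j
    · simp
    · rw [sub_mul, one_mul, mul_assoc, map_sub, PowerSeries.coeff_C_mul,
        PowerSeries.coeff_succ_X_mul]
      simp [PowerSeries.coeff_one, pow_succ']
  have heul : ∀ z : A, euler (PowerSeries.mk fun k => z ^ k) =
      ((PowerSeries.mk fun k => z ^ k) - 1) * PowerSeries.mk fun k => z ^ k := by
    intro z
    ext j
    rw [coeff_euler, PowerSeries.coeff_mk, sub_mul, one_mul, map_sub, PowerSeries.coeff_mul]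
    simp only [PowerSeries.coeff_mk]
    rw [sum_congr rfl fun p hp => show z ^ p.1 * z ^ p.2 = z ^ j by
      rw [← pow_add, HasAntidiagonal.mem_antidiagonal.mp hp]]
    simp [add_smul, Nat.cast_smul_eq_nsmul]
  have hlin : euler (1 - PowerSeries.C x * PowerSeries.X : PowerSeries A) =
      -(PowerSeries.C x * PowerSeries.X) := by
    ext j
    rw [coeff_euler]
    rcases j with _ | _ | j <;> simp [PowerSeries.coeff_one]
  have hlog : euler (PowerSeries.mk fun r => (1 / (r : ℚ)) • (y ^ r - x ^ r)) =
      (PowerSeries.mk fun k => y ^ k) - PowerSeries.mk fun k => x ^ k := by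
    ext j
    rw [coeff_euler, PowerSeries.coeff_mk, smul_smul]
    rcases Nat.eq_zero_or_pos j with rfl | hj
    · simp
    · have : (j : ℚ) ≠ 0 := by positivity
      simp [this]
  refine (eq_expSeries (by simp) (by simp) ?_).symm
  rw [euler_mul, heul, hlin, hlog]
  linear_combination (PowerSeries.mk fun k => y ^ k) * geom x

end EulerComm

/-! ### Vertex operators -/

section IntegerIndex

/-- The coefficient of a power series at an integer index; it is `0` at negative indices. -/
def zcoeff {R : Type*} [Semiring R] (f : PowerSeries R) (m : ℤ) : R :=
  if 0 ≤ m then PowerSeries.coeff m.toNat f else 0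

variable {R : Type*} [Semiring R]

theorem zcoeff_natCast (f : PowerSeries R) (j : ℕ) : zcoeff f j = PowerSeries.coeff j f := by
  simp [zcoeff]

theorem zcoeff_of_neg (f : PowerSeries R) {m : ℤ} (h : m < 0) : zcoeff f m = 0 :=
  if_neg (not_le.mpr h)

theorem zcoeff_one (m : ℤ) : zcoeff (1 : PowerSeries R) m = if m = 0 then 1 else 0 := by
  rcases lt_or_ge m 0 with h | h
  · rw [zcoeff_of_neg _ h, if_neg h.ne]
  · lift m to ℕ using h
    rw [zcoeff_natCast, PowerSeries.coeff_one]
    simp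

theorem sum_antidiagonal_eq_finsum {M : Type*} [AddCommMonoid M] (N : ℕ) (F : ℤ → M)
    (hF : ∀ k, k < 0 ∨ (N : ℤ) < k → F k = 0) :
    ∑ p ∈ HasAntidiagonal.antidiagonal N, F p.2 = ∑ᶠ k, F k := by
  rw [finsum_eq_sum_of_support_subset (s := (range (N + 1)).map Nat.castEmbedding)]
  · rw [sum_map, ← Finset.Nat.sum_antidiagonal_swap, Finset.Nat.sum_antidiagonal_eq_sum_range_succ_mk]
    rfl
  · intro k hk
    have h : ¬ (k < 0 ∨ (N : ℤ) < k) := fun h => hk (hF k h)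
    push Not at h
    simp only [coe_map, Nat.castEmbedding_apply, Set.mem_image, coe_range, Set.mem_Iio]
    exact ⟨k.toNat, by omega, by simp [h.1]⟩

theorem zcoeff_mul (f g : PowerSeries R) (N : ℤ) :
    zcoeff (g * f) N = ∑ᶠ k : ℤ, zcoeff g (N - k) * zcoeff f k := by
  rcases lt_or_ge N 0 with h | h
  · rw [zcoeff_of_neg _ h, finsum_eq_zero_of_forall_eq_zero]
    intro k
    rcases lt_or_ge k 0 with hk | hk
    · rw [zcoeff_of_neg f hk, mul_zero]
    · rw [zcoeff_of_neg g (by omega), zero_mul]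
  · lift N to ℕ using h
    rw [zcoeff_natCast, PowerSeries.coeff_mul, ← sum_antidiagonal_eq_finsum N]
    · refine sum_congr rfl fun p hp => ?_
      rw [HasAntidiagonal.mem_antidiagonal] at hp
      rw [zcoeff_natCast, show (N : ℤ) - p.2 = p.1 by omega, zcoeff_natCast]
    · rintro k (hk | hk)
      · rw [zcoeff_of_neg f hk, mul_zero]
      · rw [zcoeff_of_neg g (by omega), zero_mul]

end IntegerIndex

section Operators

variable {K : Type*} [CommRing K]

theorem tvar_natCast (r : ℕ+) : tvar K (r : ℕ) = MvPolynomial.X r := by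
  simp [tvar]

theorem tvar_zero : tvar K 0 = 0 := by simp [tvar]

theorem dt_X_mul (r : ℕ) (k : ℕ+) (f : Lam K) :
    dt K r (MvPolynomial.X k * f) =
      MvPolynomial.X k * dt K r f + if r = k then f else 0 := by
  rcases Nat.eq_zero_or_pos r with rfl | hr
  · rw [dt_of_nonpos (by simp), if_neg k.pos.ne]; simp
  · lift r to ℕ+ using hr
    rw [dt_apply_of_pos, dt_apply_of_pos, Derivation.leibniz, MvPolynomial.pderiv_X]
    simp only [PNat.coe_inj, smul_eq_mul]
    congr 1
    by_cases h : r = k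
    · subst h; simp
    · rw [if_neg h, Pi.single_eq_of_ne (Ne.symm h), mul_zero]

/-- The operator `∑_j e_{m+j} T_j` applied to a polynomial `f`, given the polynomial
`∑_j (T_j f) v ^ j`. -/
def contract (e : PowerSeries (Lam K)) (m : ℤ) : Polynomial (Lam K) →ₗ[K] Lam K :=
  Polynomial.lsum fun j => LinearMap.mulLeft K (zcoeff e (m + j))

theorem contract_monomial (e : PowerSeries (Lam K)) (m : ℤ) (j : ℕ) (x : Lam K) :
    contract e m (Polynomial.monomial j x) = zcoeff e (m + j) * x := by
  simp [contract, Polynomial.lsum_apply, Polynomial.sum_monomial_index]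

theorem contract_monomial_mul (e : PowerSeries (Lam K)) (m : ℤ) (k : ℕ) (x : Lam K)
    (p : Polynomial (Lam K)) :
    contract e m (Polynomial.monomial k x * p) = x * contract e (m + k) p := by
  induction p using Polynomial.induction_on' with
  | add p q hp hq => rw [mul_add, map_add, map_add, hp, hq, mul_add]
  | monomial j y =>
    rw [Polynomial.monomial_mul_monomial, contract_monomial, contract_monomial]
    push_cast
    rw [add_assoc]
    ring

theorem dt_C (r : ℤ) (x : K) : dt K r (MvPolynomial.C x) = 0 := by
  rw [dt]
  split_ifs <;> simp

theorem commute_dt (r s : ℕ) : Commute (dt K r) (dt K s) := by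
  refine LinearMap.ext fun f => ?_
  rw [Module.End.mul_apply, Module.End.mul_apply]
  induction f using MvPolynomial.induction_on with
  | C x => simp [dt_C]
  | add f g hf hg => simp only [map_add, hf, hg]
  | mul_X f k hf =>
    simp only [mul_comm f, dt_X_mul, map_add, hf, apply_ite (dt K _), map_zero]
    abel

end Operators

section VertexOperators

variable {K : Type*} [CommRing K] [Algebra ℚ K]

/-- The series `exp (∑_{r ≥ 1} α_r t_r u ^ r)`. -/
def expX (α : ℕ → K) : PowerSeries (Lam K) := expSeries (PowerSeries.mk fun r => α r • tvar K r)

theorem coeff_zero_expX (α : ℕ → K) : PowerSeries.coeff 0 (expX α) = 1 := coeff_zero_expSeries _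

theorem expX_add (α β : ℕ → K) : expX (α + β) = expX α * expX β := by
  rw [expX, expX, expX, ← expSeries_add (by simp [tvar_zero]) (by simp [tvar_zero])]
  congr 1
  ext1 r
  simp [add_smul]

theorem expX_zero : expX (0 : ℕ → K) = 1 := by
  rw [expX, ← expSeries_zero]
  congr 1
  ext1 r
  simp

theorem expX_rescale (x : K) (α : ℕ → K) :
    PowerSeries.rescale (algebraMap K (Lam K) x) (expX α) = expX fun r => x ^ r * α r := by
  rw [expX, expSeries_rescale, expX]
  congr 1
  ext1 r
  rw [PowerSeries.coeff_rescale, PowerSeries.coeff_mk, PowerSeries.coeff_mk, ← map_pow,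
    ← Algebra.smul_def, smul_smul]

/-- Newton's recursion for the coefficients of `expX α`. -/
theorem newton_expX (α : ℕ → K) (j : ℕ) :
    (j : ℚ) • PowerSeries.coeff j (expX α) = ∑ p ∈ HasAntidiagonal.antidiagonal j,
      ((p.1 : ℚ) • α p.1 • tvar K p.1) * PowerSeries.coeff p.2 (expX α) := by
  rw [← coeff_euler, expX, euler_expSeries (by simp [tvar_zero]) fun _ _ => Commute.all _ _,
    PowerSeries.coeff_mul]
  simp only [coeff_euler, PowerSeries.coeff_mk]

/-- The algebra map `t_r ↦ t_r + β_r v ^ r`, which is `exp (∑_{r ≥ 1} β_r v ^ r ∂/∂t_r)` by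
Taylor's formula. -/
def shift (K : Type*) [CommRing K] [Algebra ℚ K] (β : ℕ → ℚ) : Lam K →ₐ[K] Polynomial (Lam K) :=
  MvPolynomial.aeval fun r : ℕ+ =>
    Polynomial.C (MvPolynomial.X r) + Polynomial.monomial r (algebraMap ℚ (Lam K) (β r))

/-- The coefficient of `u ^ m` in the vertex operator
`exp (∑ α_r t_r u ^ r) exp (∑ β_r u ^ (-r) ∂/∂t_r)`. -/
def vop (α : ℕ → K) (β : ℕ → ℚ) (m : ℤ) : Lam K →ₗ[K] Lam K :=
  contract (expX α) m ∘ₗ (shift K β).toLinearMap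

variable (α : ℕ → K) (β : ℕ → ℚ)

theorem vop_apply (m : ℤ) (f : Lam K) : vop α β m f = contract (expX α) m (shift K β f) := rfl

theorem vop_one (m : ℤ) : vop α β m 1 = zcoeff (expX α) m := by
  rw [vop_apply, map_one, ← Polynomial.C_1, ← Polynomial.monomial_zero_left, contract_monomial]
  simp

/-- The commutator of a vertex operator with the multiplication by `t_k`. -/
theorem vop_X_mul (m : ℤ) (k : ℕ+) (f : Lam K) :
    vop α β m (MvPolynomial.X k * f) =
      MvPolynomial.X k * vop α β m f + β k • vop α β (m + k) f := by
  have h : shift K β (MvPolynomial.X k) = Polynomial.monomial 0 (MvPolynomial.X k) +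
      Polynomial.monomial (k : ℕ) (algebraMap ℚ (Lam K) (β k)) := by
    rw [shift, MvPolynomial.aeval_X, Polynomial.monomial_zero_left]
  rw [vop_apply, map_mul, h, add_mul, map_add, contract_monomial_mul, contract_monomial_mul,
    Algebra.smul_def, Nat.cast_zero, add_zero]
  rfl

/-- The series `exp (∑ β_r γ_r w ^ r)` by which `exp (∑ β_r v ^ r ∂/∂t_r)` multiplies
`exp (∑ γ_r t_r u ^ r)`, where `w = u v`. -/
def pairing (β : ℕ → ℚ) (γ : ℕ → K) : PowerSeries K :=
  expSeries (PowerSeries.mk fun r => β r • γ r)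

theorem shift_expX (hβ : β 0 = 0) (γ : ℕ → K) :
    PowerSeries.map (shift K β : Lam K →+* Polynomial (Lam K)) (expX γ) =
      PowerSeries.map Polynomial.C (expX γ) *
        PowerSeries.rescale Polynomial.X
          (PowerSeries.map (algebraMap K (Polynomial (Lam K))) (pairing β γ)) := by
  rw [expX, pairing, expSeries_map, expSeries_map, expSeries_map, expSeries_rescale,
    ← expSeries_add (by simp [tvar_zero]) (by simp [hβ])]
  congr 1
  ext1 r
  simp only [map_add, PowerSeries.coeff_map, PowerSeries.coeff_mk, PowerSeries.coeff_rescale]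
  rcases Nat.eq_zero_or_pos r with rfl | hr
  · simp [tvar_zero, hβ]
  · lift r to ℕ+ using hr
    rw [tvar_natCast, RingHom.coe_coe, map_smul, shift, MvPolynomial.aeval_X, smul_add,
      ← Polynomial.smul_C, ← Polynomial.C_mul_X_pow_eq_monomial, map_rat_smul, Algebra.smul_def,
      Algebra.smul_def (β r), Algebra.smul_def (γ r) (_ * _),
      show Polynomial.C (algebraMap ℚ (Lam K) (β r)) = algebraMap ℚ (Polynomial (Lam K)) (β r)
        from rfl]
    ring

theorem vop_coeff_expX (hβ : β 0 = 0) (γ : ℕ → K) (m : ℤ) (N : ℕ) :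
    vop α β m (PowerSeries.coeff N (expX γ)) = ∑ p ∈ HasAntidiagonal.antidiagonal N,
      PowerSeries.coeff p.2 (pairing β γ) •
        (zcoeff (expX α) (m + p.2) * PowerSeries.coeff p.1 (expX γ)) := by
  have h := congrArg (PowerSeries.coeff N) (shift_expX β hβ γ)
  rw [PowerSeries.coeff_map, PowerSeries.coeff_mul] at h
  rw [vop_apply]
  erw [h]
  rw [map_sum]
  refine sum_congr rfl fun p _ => ?_
  rw [PowerSeries.coeff_map, PowerSeries.coeff_rescale, PowerSeries.coeff_map, mul_left_comm,
    mul_comm, mul_assoc, mul_comm, mul_assoc, ← Algebra.smul_def, map_smul, mul_comm,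
    Polynomial.C_mul_X_pow_eq_monomial, contract_monomial]

theorem vop_zcoeff_expX (hβ : β 0 = 0) (γ : ℕ → K) (m N : ℤ) :
    vop α β m (zcoeff (expX γ) N) = ∑ᶠ k : ℤ, zcoeff (pairing β γ) k •
        (zcoeff (expX α) (m + k) * zcoeff (expX γ) (N - k)) := by
  rcases lt_or_ge N 0 with h | h
  · rw [zcoeff_of_neg _ h, map_zero, finsum_eq_zero_of_forall_eq_zero]
    intro k
    rcases lt_or_ge k 0 with hk | hk
    · rw [zcoeff_of_neg _ hk, zero_smul]
    · rw [zcoeff_of_neg (expX γ) (by omega), mul_zero, smul_zero]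
  · lift N to ℕ using h
    rw [zcoeff_natCast, vop_coeff_expX α β hβ, ← sum_antidiagonal_eq_finsum N]
    · refine sum_congr rfl fun p hp => ?_
      rw [HasAntidiagonal.mem_antidiagonal] at hp
      rw [zcoeff_natCast, show (N : ℤ) - p.2 = p.1 by omega, zcoeff_natCast]
    · rintro k (hk | hk)
      · rw [zcoeff_of_neg _ hk, zero_smul]
      · rw [zcoeff_of_neg (expX γ) (by omega), mul_zero, smul_zero]

/-! ### Comparison of `vertexOp` with the shift -/

/-- The series `∑_j T_j v ^ j` of the coefficients `T_j` of the shift. -/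
def shiftSeries (K : Type*) [CommRing K] [Algebra ℚ K] (β : ℕ → ℚ) :
    PowerSeries (Module.End K (Lam K)) :=
  PowerSeries.mk fun j => ((Polynomial.lcoeff (Lam K) j).restrictScalars K) ∘ₗ (shift K β).toLinearMap

theorem coeff_shiftSeries (j : ℕ) (f : Lam K) :
    PowerSeries.coeff j (shiftSeries K β) f = (shift K β f).coeff j := by
  rw [shiftSeries, PowerSeries.coeff_mk]; rfl

/-- The exponent `∑ β_r v ^ r ∂/∂t_r` of the annihilation part. -/
def annExponent (K : Type*) [CommRing K] [Algebra ℚ K] (β : ℕ → ℚ) :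
    PowerSeries (Module.End K (Lam K)) :=
  PowerSeries.mk fun r => β r • dt K r

theorem euler_C (T : Module.End K (Lam K)) : euler (PowerSeries.C T) = 0 := by
  ext1 j
  rw [coeff_euler, PowerSeries.coeff_C]
  split_ifs with h <;> simp [h]

theorem shiftSeries_mul_C (k : ℕ+) :
    shiftSeries K β * PowerSeries.C (LinearMap.mulLeft K (MvPolynomial.X k)) =
      PowerSeries.C (LinearMap.mulLeft K (MvPolynomial.X k)) * shiftSeries K β +
        β k • (PowerSeries.X ^ (k : ℕ) * shiftSeries K β) := by
  ext1 j
  refine LinearMap.ext fun f => ?_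
  rw [PowerSeries.coeff_mul_C, map_add, PowerSeries.coeff_C_mul, coeff_smul_rat,
    PowerSeries.coeff_X_pow_mul', Module.End.mul_apply, LinearMap.mulLeft_apply, coeff_shiftSeries,
    LinearMap.add_apply, Module.End.mul_apply, LinearMap.mulLeft_apply, coeff_shiftSeries,
    LinearMap.smul_apply, map_mul, shift, MvPolynomial.aeval_X, add_mul, Polynomial.coeff_add,
    Polynomial.coeff_C_mul, ← Polynomial.C_mul_X_pow_eq_monomial, mul_assoc,
    Polynomial.coeff_C_mul, Polynomial.coeff_X_pow_mul', Algebra.smul_def]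
  split_ifs
  · rw [coeff_shiftSeries]; rfl
  · rfl

theorem euler_annExponent_mul_C (k : ℕ+) :
    euler (annExponent K β) * PowerSeries.C (LinearMap.mulLeft K (MvPolynomial.X k)) =
      PowerSeries.C (LinearMap.mulLeft K (MvPolynomial.X k)) * euler (annExponent K β) +
        β k • euler (PowerSeries.X ^ (k : ℕ)) := by
  ext1 j
  refine LinearMap.ext fun f => ?_
  rw [PowerSeries.coeff_mul_C, map_add, PowerSeries.coeff_C_mul, coeff_smul_rat, coeff_euler,
    coeff_euler, PowerSeries.coeff_X_pow, annExponent, PowerSeries.coeff_mk]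
  simp only [Module.End.mul_apply, LinearMap.mulLeft_apply, LinearMap.add_apply,
    LinearMap.smul_apply, dt_X_mul, smul_add, mul_smul_comm]
  congr 1
  split_ifs with h
  · rw [h, smul_comm]; rfl
  · simp

/-- The shift is the exponential of its infinitesimal generator. -/
theorem shiftSeries_eq (β : ℕ → ℚ) (hβ : β 0 = 0) :
    shiftSeries K β = expSeries (annExponent K β) := by
  have ha0 : PowerSeries.coeff 0 (annExponent K β) = 0 := by simp [annExponent, hβ]
  have hcomm : ∀ r s, Commute (PowerSeries.coeff r (annExponent K β))
      (PowerSeries.coeff s (annExponent K β)) := by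
    intro r s
    rw [annExponent, PowerSeries.coeff_mk, PowerSeries.coeff_mk]
    refine ((?_ : Commute (dt K r) (dt K s)).smul_left _).smul_right _
    exact commute_dt r s
  have key : euler (shiftSeries K β) - euler (annExponent K β) * shiftSeries K β = 0 := by
    set S := shiftSeries K β
    set a := annExponent K β
    have hone : ∀ j, PowerSeries.coeff j S 1 = if j = 0 then 1 else 0 := fun j => by
      rw [coeff_shiftSeries, map_one, Polynomial.coeff_one]
    have hrec : ∀ k : ℕ+, (euler S - euler a * S) *
        PowerSeries.C (LinearMap.mulLeft K (MvPolynomial.X k)) =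
        PowerSeries.C (LinearMap.mulLeft K (MvPolynomial.X k)) * (euler S - euler a * S) +
          β k • (PowerSeries.X ^ (k : ℕ) * (euler S - euler a * S)) := by
      intro k
      have h1 := congrArg euler (shiftSeries_mul_C β k (K := K))
      rw [euler_mul, euler_C, mul_zero, add_zero, euler_add, euler_mul, euler_C, zero_mul, zero_add,
        euler_smul_rat, euler_mul] at h1
      rw [sub_mul, h1, mul_assoc, shiftSeries_mul_C, mul_add, ← mul_assoc (euler a),
        euler_annExponent_mul_C, mul_smul_comm, ← mul_assoc (euler a), PowerSeries.commute_X_pow,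
        add_mul, mul_sub, mul_sub, smul_sub, smul_add, smul_mul_assoc, mul_assoc, mul_assoc]
      abel
    ext1 j
    refine LinearMap.ext fun f => ?_
    rw [map_zero, LinearMap.zero_apply]
    induction f using MvPolynomial.induction_on generalizing j with
    | C x =>
      have hx : (MvPolynomial.C x : Lam K) = x • 1 := by
        rw [MvPolynomial.smul_eq_C_mul, mul_one]
      rw [hx, map_smul, map_sub, LinearMap.sub_apply, coeff_euler, PowerSeries.coeff_mul,
        LinearMap.smul_apply, hone, LinearMap.sum_apply, Finset.sum_eq_single (j, 0)]
      · rw [Module.End.mul_apply, hone, coeff_euler, if_pos rfl]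
        have : (PowerSeries.coeff j a) 1 = 0 := by
          simp only [a, annExponent, PowerSeries.coeff_mk, LinearMap.smul_apply, dt]
          split_ifs <;> simp
        rw [LinearMap.smul_apply, this]
        split_ifs with h <;> simp [h]
      · intro p hp hne
        rw [HasAntidiagonal.mem_antidiagonal] at hp
        rw [Module.End.mul_apply, hone, if_neg, map_zero]
        rintro h
        exact hne (Prod.ext (by omega) h)
      · intro h; simp at h
    | add f g hf hg => rw [map_add, hf, hg, add_zero]
    | mul_X f k hf =>
      have := congrArg (fun s : PowerSeries (Module.End K (Lam K)) => PowerSeries.coeff j s f) (hrec k)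
      simp only [PowerSeries.coeff_mul_C, map_add, PowerSeries.coeff_C_mul, coeff_smul_rat,
        PowerSeries.coeff_X_pow_mul', Module.End.mul_apply, LinearMap.mulLeft_apply,
        LinearMap.add_apply, LinearMap.smul_apply] at this
      rw [mul_comm, this, hf, mul_zero, zero_add]
      split_ifs
      · rw [hf, smul_zero]
      · simp
  refine eq_of_euler (b := euler (annExponent K β)) (by simp [coeff_euler]) ?_
    (sub_eq_zero.mp key) (euler_expSeries ha0 hcomm)
  rw [coeff_zero_expSeries]
  refine LinearMap.ext fun f => ?_
  rw [coeff_shiftSeries, Module.End.one_apply]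
  induction f using MvPolynomial.induction_on with
  | C x =>
    rw [← MvPolynomial.algebraMap_eq, AlgHom.commutes, Polynomial.algebraMap_apply,
      Polynomial.coeff_C_zero]
  | add f g hf hg => rw [map_add, Polynomial.coeff_add, hf, hg]
  | mul_X f k hf =>
    rw [map_mul, Polynomial.mul_coeff_zero, hf, shift, MvPolynomial.aeval_X,
      Polynomial.coeff_add, Polynomial.coeff_C_zero, Polynomial.coeff_monomial, if_neg k.pos.ne',
      add_zero]

/-- The operators `B_m` as vertex operators of the general form `vop`. -/
theorem vertexOp_eq_vop (ρ : K) (m : ℤ) (f : Lam K) :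
    vertexOp ρ m f = vop (fun r => 1 - ρ ^ r) (fun r => -(1 / (r : ℚ))) m f := by
  have hann : annihilation K = shiftSeries K fun r => -(1 / (r : ℚ)) := by
    rw [shiftSeries_eq _ (by simp), annihilation, annExponent]
    congr 1
    ext1 r
    rw [PowerSeries.coeff_mk, PowerSeries.coeff_mk]
    exact (neg_smul _ _).symm
  rw [vertexOp, vop_apply, contract, Polynomial.lsum_apply, Polynomial.sum_def,
    finsum_eq_sum_of_support_subset (s := (shift K (fun r => -(1 / (r : ℚ))) f).support)]
  · refine sum_congr rfl fun j _ => ?_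
    rw [hann, coeff_shiftSeries, LinearMap.mulLeft_apply, zcoeff, ite_mul, zero_mul]
    rfl
  · intro j hj
    rw [mem_coe, Polynomial.mem_support_iff]
    refine fun h => hj ?_
    simp only [hann, coeff_shiftSeries, h, mul_zero, ite_self]

end VertexOperators

/-! ### The quadratic relation between `B` and `C` -/

theorem zcoeff_geom {K : Type*} [CommRing K] (x y : K) (k : ℤ) :
    zcoeff ((1 - PowerSeries.C x * PowerSeries.X) * PowerSeries.mk fun k => y ^ k) k =
      if k < 0 then 0 else if k = 0 then 1 else y ^ k.toNat - x * y ^ (k.toNat - 1) := by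
  split_ifs with h h
  · exact zcoeff_of_neg _ h
  · rw [h, ← Nat.cast_zero, zcoeff_natCast]; simp
  · obtain ⟨j, rfl⟩ : ∃ j : ℕ, k = (j + 1 : ℕ) := ⟨k.toNat - 1, by omega⟩
    rw [zcoeff_natCast, sub_mul, one_mul, mul_assoc, map_sub, PowerSeries.coeff_C_mul,
      PowerSeries.coeff_succ_X_mul]
    simp

section Relations

variable {K : Type*} [CommRing K] [Algebra ℚ K]

/-- The operator `B_a` as a linear map. As `1 / 0 = 0`, the terms with `r = 0`
vanish. -/
def bop (ρ : K) (a : ℤ) : Lam K →ₗ[K] Lam K :=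
  vop (fun r => 1 - ρ ^ r) (fun r => -(1 / (r : ℚ))) a

/-- The operator `C_a`, the coefficient of `u ^ a` in
`exp (-∑ (1 - ρ ^ r) t_r u ^ (-r)) exp (∑ r⁻¹ u ^ r ∂/∂t_r)`; it is the adjoint of `B_a` for the
Hall-Littlewood inner product. -/
def cop (ρ : K) (a : ℤ) : Lam K →ₗ[K] Lam K :=
  vop (fun r => ρ ^ r - 1) (fun r => 1 / (r : ℚ)) (-a)

/-- The coefficients of `exp (∑ (1 - σ ^ r) t_r u ^ r)`, at integer indices. -/
def qpos (σ : K) (N : ℤ) : Lam K := zcoeff (expX fun r => 1 - σ ^ r) N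

/-- The coefficients of `exp (-∑ (1 - σ ^ r) t_r u ^ r)`, at integer indices. -/
def qneg (σ : K) (N : ℤ) : Lam K := zcoeff (expX fun r => σ ^ r - 1) N

theorem qpos_of_neg (σ : K) {N : ℤ} (h : N < 0) : qpos σ N = 0 := zcoeff_of_neg _ h

theorem qneg_of_neg (σ : K) {N : ℤ} (h : N < 0) : qneg σ N = 0 := zcoeff_of_neg _ h

theorem qneg_zero (σ : K) : qneg σ 0 = 1 := by
  rw [qneg, ← Nat.cast_zero, zcoeff_natCast, coeff_zero_expX]

variable (ρ : K)

theorem bop_one (a : ℤ) : bop ρ a 1 = qpos ρ a := vop_one _ _ _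

theorem cop_one (a : ℤ) : cop ρ a 1 = qneg ρ (-a) := vop_one _ _ _

theorem bop_X_mul (a : ℤ) (k : ℕ+) (f : Lam K) :
    bop ρ a (MvPolynomial.X k * f) =
      MvPolynomial.X k * bop ρ a f - (1 / ((k : ℕ) : ℚ)) • bop ρ (a + k) f := by
  rw [bop, vop_X_mul, neg_smul, ← sub_eq_add_neg]
  rfl

theorem cop_X_mul (a : ℤ) (k : ℕ+) (f : Lam K) :
    cop ρ a (MvPolynomial.X k * f) =
      MvPolynomial.X k * cop ρ a f + (1 / ((k : ℕ) : ℚ)) • cop ρ (a - k) f := by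
  rw [cop, vop_X_mul, cop, show -a + (k : ℤ) = -(a - k) by ring]

theorem pairing_log {β : ℕ → ℚ} {γ : ℕ → K} (x y : K)
    (h : ∀ r, β r • γ r = (1 / (r : ℚ)) • (y ^ r - x ^ r)) :
    pairing β γ = (1 - PowerSeries.C x * PowerSeries.X) * PowerSeries.mk fun k => y ^ k := by
  rw [← expSeries_log, pairing]
  congr 1
  ext1 r
  rw [PowerSeries.coeff_mk, PowerSeries.coeff_mk, h]

/-- The coefficients of `(1 - ρ w) / (1 - w)`. -/
def kappa (k : ℤ) : K := if k < 0 then 0 else if k = 0 then 1 else 1 - ρ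

theorem zcoeff_pairing_kappa {β : ℕ → ℚ} {γ : ℕ → K}
    (h : ∀ r, β r • γ r = (1 / (r : ℚ)) • (1 - ρ ^ r)) (k : ℤ) :
    zcoeff (pairing β γ) k = kappa ρ k := by
  rw [pairing_log ρ 1 (by simpa using h), zcoeff_geom]
  simp [kappa]

theorem cop_qpos (a b : ℤ) :
    cop ρ a (qpos ρ b) = ∑ k ∈ Icc a b, kappa ρ k • (qneg ρ (k - a) * qpos ρ (b - k)) := by
  rw [cop, qpos, vop_zcoeff_expX _ _ (by simp), finsum_eq_sum_of_support_subset (s := Icc a b)]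
  · refine sum_congr rfl fun k _ => ?_
    rw [zcoeff_pairing_kappa ρ fun r => rfl, neg_add_eq_sub]
    rfl
  · intro k hk
    rw [Function.mem_support] at hk
    rw [mem_coe, mem_Icc]
    constructor <;> by_contra hlt
    · exact hk (by rw [zcoeff_of_neg (expX fun r => ρ ^ r - 1) (by omega), zero_mul, smul_zero])
    · exact hk (by rw [zcoeff_of_neg (expX fun r => 1 - ρ ^ r) (by omega), mul_zero, smul_zero])

theorem bop_qneg (a b : ℤ) :
    bop ρ b (qneg ρ (-a)) =
      ∑ k ∈ Icc a b, kappa ρ (-k) • (qneg ρ (k - a) * qpos ρ (b - k)) := by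
  rw [bop, qneg, vop_zcoeff_expX _ _ (by simp), ← finsum_comp_equiv (Equiv.neg ℤ),
    finsum_eq_sum_of_support_subset (s := Icc a b)]
  · refine sum_congr rfl fun k _ => ?_
    rw [zcoeff_pairing_kappa ρ fun r => by rw [neg_smul, ← smul_neg, neg_sub], Equiv.neg_apply,
      ← sub_eq_add_neg, neg_sub_neg, mul_comm]
    rfl
  · intro k hk
    rw [Function.mem_support] at hk
    rw [mem_coe, mem_Icc]
    rw [Equiv.neg_apply] at hk
    constructor <;> by_contra hlt
    · exact hk (by rw [zcoeff_of_neg (expX fun r => ρ ^ r - 1) (by omega), mul_zero, smul_zero])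
    · exact hk (by rw [zcoeff_of_neg (expX fun r => 1 - ρ ^ r) (by omega), zero_mul, smul_zero])

/-- `qpos` and `qneg` are the coefficients of inverse series. -/
theorem sum_qneg_mul_qpos (a b : ℤ) :
    ∑ k ∈ Icc a b, qneg ρ (k - a) * qpos ρ (b - k) = if a = b then 1 else 0 := by
  have h : (expX fun r => 1 - ρ ^ r) * (expX fun r => ρ ^ r - 1) = 1 := by
    rw [← expX_add, ← expX_zero]
    congr 1
    ext r
    simp
  have h2 := zcoeff_mul (expX fun r => ρ ^ r - 1) (expX fun r => 1 - ρ ^ r) (b - a)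
  rw [h, zcoeff_one, ← finsum_comp_equiv (Equiv.subRight a),
    finsum_eq_sum_of_support_subset (s := Icc a b)] at h2
  · have e : (if a = b then (1 : Lam K) else 0) = if b - a = 0 then 1 else 0 := by
      simp only [sub_eq_zero, eq_comm]
    rw [e, h2]
    refine sum_congr rfl fun k _ => ?_
    rw [Equiv.subRight_apply, sub_sub_sub_cancel_right, mul_comm]
    rfl
  · intro k hk
    rw [Function.mem_support, Equiv.subRight_apply, sub_sub_sub_cancel_right] at hk
    rw [mem_coe, mem_Icc]
    constructor <;> by_contra hlt
    · exact hk (by rw [zcoeff_of_neg (expX fun r => ρ ^ r - 1) (by omega), mul_zero])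
    · exact hk (by rw [zcoeff_of_neg (expX fun r => 1 - ρ ^ r) (by omega), zero_mul])

/-- The quadratic relation between the operators `B` and `C`, in generating functions
`(w - ρ) C(u) B(v) + (1 - ρ w) B(v) C(u) = (1 - ρ) ^ 2 ∑_k w ^ k` with `w = u v`. Both sides have the
same commutators with the multiplications by the variables, so it is enough to compare the values
at `1`. -/
theorem cop_bop_relation (a b : ℤ) (f : Lam K) :
    cop ρ (a - 1) (bop ρ (b - 1) f) - ρ • cop ρ a (bop ρ b f) + bop ρ b (cop ρ a f)
      - ρ • bop ρ (b - 1) (cop ρ (a - 1) f) = if a = b then (1 - ρ) ^ 2 • f else 0 := by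
  induction f using MvPolynomial.induction_on generalizing a b with
  | C x =>
    have hx : (MvPolynomial.C x : Lam K) = x • 1 := by
      rw [MvPolynomial.smul_eq_C_mul, mul_one]
    have key : cop ρ (a - 1) (bop ρ (b - 1) 1) - ρ • cop ρ a (bop ρ b 1) + bop ρ b (cop ρ a 1)
        - ρ • bop ρ (b - 1) (cop ρ (a - 1) 1) = if a = b then (1 - ρ) ^ 2 • 1 else 0 := by
      have s1 : ∀ φ : ℤ → K, ∑ k ∈ Icc (a - 1) (b - 1), φ k •
          (qneg ρ (k - (a - 1)) * qpos ρ (b - 1 - k)) =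
          ∑ k ∈ Icc a b, φ (k - 1) • (qneg ρ (k - a) * qpos ρ (b - k)) := by
        intro φ
        refine (sum_bij' (fun k _ => k - 1) (fun k _ => k + 1) ?_ ?_ ?_ ?_ ?_).symm
        · intro k hk; rw [mem_Icc] at hk ⊢; omega
        · intro k hk; rw [mem_Icc] at hk ⊢; omega
        · intro k _; ring
        · intro k _; ring
        · intro k _
          rw [show k - 1 - (a - 1) = k - a by ring, show b - 1 - (k - 1) = b - k by ring]
      rw [bop_one, bop_one, cop_one, cop_one, cop_qpos, cop_qpos, bop_qneg, bop_qneg,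
        s1 (kappa ρ), s1 fun k => kappa ρ (-k), Finset.smul_sum, Finset.smul_sum,
        ← sum_sub_distrib, ← sum_add_distrib, ← sum_sub_distrib]
      have : ∀ k : ℤ, kappa ρ (k - 1) - ρ * kappa ρ k + kappa ρ (-k) - ρ * kappa ρ (-(k - 1)) =
          (1 - ρ) ^ 2 := by
        intro k
        simp only [kappa]
        split_ifs <;> first | omega | ring
      simp only [smul_smul, ← sub_smul, ← add_smul, this]
      rw [← Finset.smul_sum, sum_qneg_mul_qpos, smul_ite, smul_zero]
    rw [hx]
    simp only [map_smul, smul_comm ρ x, ← smul_sub, ← smul_add, key]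
    rw [smul_ite, smul_zero, smul_comm]
  | add f g hf hg =>
    have := congrArg₂ (· + ·) (hf a b) (hg a b)
    simp only [map_add, smul_add]
    rw [ite_add_ite, add_zero] at this
    rw [← this]
    abel
  | mul_X f k hf =>
    have e1 := hf a b
    have e2 := hf (a - k) b
    have e3 := hf a (b + k)
    rw [show a - (k : ℤ) - 1 = a - 1 - k by ring] at e2
    rw [show b + (k : ℤ) - 1 = b - 1 + k by ring] at e3
    have e4 : (if a - (k : ℤ) = b then (1 - ρ) ^ 2 • f else 0) =
        if a = b + (k : ℤ) then (1 - ρ) ^ 2 • f else 0 := by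
      congr 1; exact propext sub_eq_iff_eq_add
    rw [mul_comm f]
    simp only [bop_X_mul, cop_X_mul, map_add, map_sub, map_rat_smul]
    have e5 : (if a = b then (1 - ρ) ^ 2 • (MvPolynomial.X k * f) else 0) =
        MvPolynomial.X k * if a = b then (1 - ρ) ^ 2 • f else 0 := by
      rw [mul_ite, mul_zero, mul_smul_comm]
    rw [e5, ← e1]
    have e6 := congrArg (fun x => (1 / ((k : ℕ) : ℚ)) • x) (e2.trans (e4.trans e3.symm))
    simp only [Algebra.smul_def] at e6 ⊢
    linear_combination e6

theorem exists_forall_cop_bop (f : Lam K) :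
    ∃ d : ℤ, ∀ a b : ℤ, d < a → cop ρ a (bop ρ b f) = if a = b then (1 - ρ) • f else 0 := by
  induction f using MvPolynomial.induction_on with
  | C x =>
    refine ⟨0, fun a b ha => ?_⟩
    have hx : (MvPolynomial.C x : Lam K) = x • 1 := by
      rw [MvPolynomial.smul_eq_C_mul, mul_one]
    rw [hx, map_smul, map_smul, bop_one, cop_qpos, sum_congr rfl fun k hk => show
      kappa ρ k • (qneg ρ (k - a) * qpos ρ (b - k)) =
        (1 - ρ) • (qneg ρ (k - a) * qpos ρ (b - k)) by
      rw [mem_Icc] at hk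
      rw [kappa, if_neg (by omega), if_neg (by omega)], ← Finset.smul_sum, sum_qneg_mul_qpos]
    rw [smul_ite, smul_zero, smul_ite, smul_zero, smul_comm]
  | add f g hf hg =>
    obtain ⟨d, hd⟩ := hf
    obtain ⟨e, he⟩ := hg
    refine ⟨max d e, fun a b ha => ?_⟩
    rw [max_lt_iff] at ha
    rw [map_add, map_add, hd a b ha.1, he a b ha.2, ite_add_ite, add_zero, smul_add]
  | mul_X f k hf =>
    obtain ⟨d, hd⟩ := hf
    have hk : 0 < ((k : ℕ) : ℤ) := by exact_mod_cast k.pos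
    refine ⟨d + k, fun a b ha => ?_⟩
    rw [mul_comm f, bop_X_mul, map_sub, map_rat_smul, cop_X_mul, hd a b (by omega),
      hd (a - k) b (by omega), hd a (b + k) (by omega)]
    have e4 : (if a - (k : ℤ) = b then (1 - ρ) • f else 0) =
        if a = b + (k : ℤ) then (1 - ρ) • f else 0 := by
      congr 1; exact propext sub_eq_iff_eq_add
    rw [e4, add_sub_cancel_right, mul_ite, mul_zero, mul_smul_comm]

theorem cop_bop_of_forall_cop_eq_zero {a : ℤ} {f : Lam K} (h : ∀ a', a < a' → cop ρ a' f = 0)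
    (b : ℤ) :
    cop ρ a (bop ρ b f) = (if a = b then (1 - ρ) • f else 0) + ρ • bop ρ b (cop ρ a f) := by
  obtain ⟨d, hd⟩ := exists_forall_cop_bop ρ f
  -- The relation, solved for the lowest pair of indices.
  have step : ∀ a' b' : ℤ, a ≤ a' → cop ρ (a' + 1) (bop ρ (b' + 1) f) =
      (if a' + 1 = b' + 1 then (1 - ρ) • f else 0) →
      cop ρ a' (bop ρ b' f) = (if a' = b' then (1 - ρ) • f else 0) +
        ρ • bop ρ b' (cop ρ a' f) := by
    intro a' b' ha' e
    have rel := cop_bop_relation ρ (a' + 1) (b' + 1) f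
    rw [e, h (a' + 1) (by omega), map_zero, add_sub_cancel_right, add_sub_cancel_right] at rel
    simp only [add_left_inj] at rel
    split_ifs at rel ⊢ <;>
    · simp only [MvPolynomial.smul_eq_C_mul, map_sub, map_pow, map_one] at rel ⊢
      linear_combination rel
  have main : ∀ (n : ℕ) (a' b' : ℤ), a < a' → d < a' + n →
      cop ρ a' (bop ρ b' f) = if a' = b' then (1 - ρ) • f else 0 := by
    intro n
    induction n with
    | zero => intro a' b' _ hn; exact hd a' b' (by simpa using hn)
    | succ n ih =>
      intro a' b' ha' hn
      rw [step a' b' ha'.le (ih _ _ (by omega) (by push_cast at hn; omega)), h a' ha', map_zero,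
        smul_zero, add_zero]
  exact step a b le_rfl (main (d - a).toNat _ _ (by omega) (by omega))

theorem map_cop_bop_of_forall_map_bop_eq_zero {b : ℤ} {g : Lam K →ₗ[K] K}
    (h : ∀ b', b < b' → ∀ f, g (bop ρ b' f) = 0) (a : ℤ) (f : Lam K) :
    g (cop ρ a (bop ρ b f)) =
      (if a = b then (1 - ρ) * g f else 0) + ρ * g (bop ρ b (cop ρ a f)) := by
  obtain ⟨d, hd⟩ := exists_forall_cop_bop ρ f
  have step : ∀ a' b' : ℤ, b ≤ b' → g (cop ρ (a' + 1) (bop ρ (b' + 1) f)) =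
      (if a' + 1 = b' + 1 then (1 - ρ) * g f else 0) →
      g (cop ρ a' (bop ρ b' f)) = (if a' = b' then (1 - ρ) * g f else 0) +
        ρ * g (bop ρ b' (cop ρ a' f)) := by
    intro a' b' hb' e
    have rel := congrArg g (cop_bop_relation ρ (a' + 1) (b' + 1) f)
    simp only [map_sub, map_add, map_smul, smul_eq_mul, apply_ite g, map_zero] at rel
    rw [e, h (b' + 1) (by omega), add_sub_cancel_right, add_sub_cancel_right] at rel
    simp only [add_left_inj] at rel
    split_ifs at rel ⊢ <;> linear_combination rel
  have main : ∀ (n : ℕ) (a' b' : ℤ), b < b' → d < a' + n →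
      g (cop ρ a' (bop ρ b' f)) = if a' = b' then (1 - ρ) * g f else 0 := by
    intro n
    induction n with
    | zero =>
      intro a' b' _ hn
      rw [hd a' b' (by simpa using hn), apply_ite g, map_zero, map_smul, smul_eq_mul]
    | succ n ih =>
      intro a' b' hb' hn
      rw [step a' b' hb'.le (ih _ _ (by omega) (by push_cast at hn; omega)), h b' hb', mul_zero,
        add_zero]
  exact step a b le_rfl (main (d - a).toNat _ _ (by omega) (by omega))

end Relations

/-! ### Duality -/

section Duality

variable {K : Type*} [CommRing K] [Algebra ℚ K]

theorem vertexOp_eq_bop (ρ : K) (a : ℤ) (f : Lam K) : vertexOp ρ a f = bop ρ a f :=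
  vertexOp_eq_vop ρ a f

/-- `B_{λ_1} ⋯ B_{λ_l} · 1` for a list `λ`. -/
def qList (ρ : K) (l : List ℤ) : Lam K := l.foldr (fun a f => bop ρ a f) 1

theorem Q_eq_qList (ρ : K) {l : ℕ} (lam : Fin l → ℤ) : Q ρ lam = qList ρ (List.ofFn lam) := by
  simp only [Q, qList, ← vertexOp_eq_bop]

theorem qList_cons (ρ : K) (a : ℤ) (l : List ℤ) : qList ρ (a :: l) = bop ρ a (qList ρ l) := rfl

/-- The functional `f ↦ ⟨Q_ν, f⟩`, that is the constant term of `C_{ν_l} ⋯ C_{ν_1} f`. -/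
def pairQ (ρ : K) : List ℤ → Lam K →ₗ[K] K
  | [] => MvPolynomial.lcoeff K 0
  | a :: ν => pairQ ρ ν ∘ₗ cop ρ a

theorem pairQ_cons (ρ : K) (a : ℤ) (ν : List ℤ) (f : Lam K) :
    pairQ ρ (a :: ν) f = pairQ ρ ν (cop ρ a f) := rfl

variable (ρ : K)

theorem pairQ_nil (f : Lam K) : pairQ ρ [] f = MvPolynomial.constantCoeff f := rfl

theorem constantCoeff_zcoeff_expX (α : ℕ → K) {m : ℤ} (hm : 0 < m) :
    MvPolynomial.constantCoeff (zcoeff (expX α) m) = 0 := by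
  lift m to ℕ using hm.le
  have h : PowerSeries.map MvPolynomial.constantCoeff (expX α) = 1 := by
    rw [expX, expSeries_map, ← expSeries_zero]
    congr 1
    ext r
    rw [PowerSeries.coeff_map, PowerSeries.coeff_mk, tvar, map_zero]
    split_ifs <;> simp
  rw [zcoeff_natCast, ← PowerSeries.coeff_map, h, PowerSeries.coeff_one, if_neg (by omega)]

theorem pairQ_nil_bop {b : ℤ} (hb : 0 < b) (f : Lam K) : pairQ ρ [] (bop ρ b f) = 0 := by
  rw [pairQ_nil, bop, vop_apply]
  induction shift K (fun r => -(1 / (r : ℚ))) f using Polynomial.induction_on' with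
  | add p q hp hq => rw [map_add, map_add, hp, hq, add_zero]
  | monomial j x =>
    rw [contract_monomial, map_mul, constantCoeff_zcoeff_expX _ (by omega), zero_mul]

theorem cop_one_of_pos {a : ℤ} (ha : 0 < a) : cop ρ a 1 = 0 := by
  rw [cop_one, qneg_of_neg _ (by omega)]

theorem cop_qList_eq_zero {a : ℤ} (ha : 0 < a) (l : List ℤ) (hl : ∀ b ∈ l, b < a) :
    cop ρ a (qList ρ l) = 0 := by
  induction l generalizing a with
  | nil => exact cop_one_of_pos ρ ha
  | cons b l ih =>
    have hlt : ∀ c ∈ l, c < a := fun c hc => hl c (List.mem_cons_of_mem _ hc)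
    have hb : b < a := hl b List.mem_cons_self
    rw [qList_cons, cop_bop_of_forall_cop_eq_zero ρ
      (fun a' ha' => ih (by omega) fun c hc => (hlt c hc).trans ha'), if_neg hb.ne', ih ha hlt,
      map_zero, smul_zero, add_zero]

theorem pairQ_bop_eq_zero {b : ℤ} (hb : 0 < b) (ν : List ℤ) (hν : ∀ a ∈ ν, a < b) (f : Lam K) :
    pairQ ρ ν (bop ρ b f) = 0 := by
  induction ν generalizing b f with
  | nil => exact pairQ_nil_bop ρ hb f
  | cons a ν ih =>
    have hlt : ∀ c ∈ ν, c < b := fun c hc => hν c (List.mem_cons_of_mem _ hc)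
    have hab : a < b := hν a List.mem_cons_self
    rw [pairQ_cons, map_cop_bop_of_forall_map_bop_eq_zero ρ
      (fun b' hb' f => ih (by omega) (fun c hc => (hlt c hc).trans hb') f), if_neg hab.ne,
      ih hb hlt, mul_zero, add_zero]

/-- `C_a` removes a largest part `a`. -/
theorem cop_qList_cons {a : ℤ} (ha : 0 < a) (l : List ℤ) (hl : (a :: l).Pairwise (· ≥ ·)) :
    cop ρ a (qList ρ (a :: l)) = (1 - ρ ^ (a :: l).count a) • qList ρ l := by
  induction l with
  | nil =>
    rw [qList_cons, cop_bop_of_forall_cop_eq_zero ρ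
      (fun a' ha' => cop_qList_eq_zero ρ (by omega) [] (by simp)), if_pos rfl,
      cop_qList_eq_zero ρ ha [] (by simp)]
    simp
  | cons b l ih =>
    rw [List.pairwise_cons, List.pairwise_cons] at hl
    have hba : ∀ c ∈ b :: l, c ≤ a := hl.1
    rw [qList_cons, cop_bop_of_forall_cop_eq_zero ρ
      (fun a' ha' => cop_qList_eq_zero ρ (by omega) _ fun c hc => (hba c hc).trans_lt ha'),
      if_pos rfl]
    rcases (hba b List.mem_cons_self).eq_or_lt with rfl | hlt
    · rw [ih (List.pairwise_cons.mpr hl.2), map_smul, ← qList_cons, smul_smul, ← add_smul,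
        List.count_cons_self (l := b :: l)]
      congr 1
      ring
    · have hlt' : ∀ c ∈ b :: l, c < a := by
        intro c hc
        rcases List.mem_cons.mp hc with rfl | hc
        · exact hlt
        · exact (hl.2.1 c hc).trans_lt hlt
      rw [cop_qList_eq_zero ρ ha _ hlt', map_zero, smul_zero, add_zero, List.count_cons_self,
        List.count_eq_zero_of_not_mem fun h => (hlt' a h).false]
      simp

theorem pairQ_qList_of_ne {ν l : List ℤ} (hν : ν.Pairwise (· ≥ ·)) (hl : l.Pairwise (· ≥ ·))
    (hν0 : ∀ a ∈ ν, 0 < a) (hl0 : ∀ a ∈ l, 0 < a) (h : ν ≠ l) : pairQ ρ ν (qList ρ l) = 0 := by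
  induction ν generalizing l with
  | nil =>
    cases l with
    | nil => exact absurd rfl h
    | cons b l => exact pairQ_nil_bop ρ (hl0 b List.mem_cons_self) _
  | cons a ν ih =>
    have ha := hν0 a List.mem_cons_self
    cases l with
    | nil => rw [pairQ_cons, show qList ρ [] = 1 from rfl, cop_one_of_pos ρ ha, map_zero]
    | cons b l =>
      have hb := hl0 b List.mem_cons_self
      rcases lt_trichotomy a b with hab | rfl | hab
      · refine pairQ_bop_eq_zero ρ hb _ (fun c hc => ?_) _
        rcases List.mem_cons.mp hc with rfl | hc
        · exact hab
        · exact (List.rel_of_pairwise_cons hν hc).trans_lt hab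
      · rw [pairQ_cons, cop_qList_cons ρ ha l hl, map_smul, ih hν.of_cons hl.of_cons
          (fun c hc => hν0 c (List.mem_cons_of_mem _ hc))
          (fun c hc => hl0 c (List.mem_cons_of_mem _ hc)) fun e => h (by rw [e]), smul_zero]
      · rw [pairQ_cons, cop_qList_eq_zero ρ ha, map_zero]
        intro c hc
        rcases List.mem_cons.mp hc with rfl | hc
        · exact hab
        · exact (List.rel_of_pairwise_cons hl hc).trans_lt hab

end Duality

section Field

variable {F : Type*} [Field F]

theorem phi_succ (k : ℕ) (x : F) : phi (k + 1) x = phi k x * (1 - x ^ (k + 1)) := by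
  rw [phi, phi, Finset.prod_Icc_succ_top (by omega)]

theorem prod_phi_count_cons (x : F) (a : ℕ) (l : List ℕ) :
    ∏ i ∈ (a :: l).toFinset, phi ((a :: l).count i) x =
      (1 - x ^ (a :: l).count a) * ∏ i ∈ l.toFinset, phi (l.count i) x := by
  have h1 : ∏ i ∈ l.toFinset, phi (l.count i) x = ∏ i ∈ (a :: l).toFinset, phi (l.count i) x := by
    rw [List.toFinset_cons]
    refine prod_subset (subset_insert _ _) fun i _ hi => ?_
    rw [List.count_eq_zero_of_not_mem (by simpa using hi)]
    simp [phi]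
  have h2 : ∀ i, phi ((a :: l).count i) x =
      (if a = i then 1 - x ^ (a :: l).count a else 1) * phi (l.count i) x := by
    intro i
    split_ifs with h
    · subst h; rw [List.count_cons_self, phi_succ, mul_comm]
    · rw [List.count_cons_of_ne h, one_mul]
  rw [h1, prod_congr rfl fun i _ => h2 i, prod_mul_distrib, prod_ite_eq, if_pos (by simp)]

theorem prod_get_eq (l : List ℕ) (x : F) :
    ∏ i : Fin l.length, (1 - x⁻¹ ^ (1 + (i : ℕ))) * x ^ ((1 + (i : ℕ)) * l.get i) =
      x ^ (∑ i : Fin l.length, ((i : ℕ) + 1) * l.get i) * phi l.length x⁻¹ := by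
  rw [prod_mul_distrib, mul_comm, prod_pow_eq_pow_sum, phi]
  congr 1
  · congr 1
    exact sum_congr rfl fun i _ => by rw [add_comm 1]
  · rw [Fin.prod_univ_eq_prod_range (fun i => 1 - x⁻¹ ^ (1 + i)), ← Finset.Ico_add_one_right_eq_Icc,
      Finset.prod_Ico_eq_prod_range]
    rfl

variable [Algebra ℚ F] (ρ : F)

theorem pairQ_qList_self (l : List ℕ) (hl : l.Pairwise (· ≥ ·)) (hl0 : ∀ a ∈ l, 0 < a) :
    pairQ ρ (l.map (↑)) (qList ρ (l.map (↑))) = ∏ i ∈ l.toFinset, phi (l.count i) ρ := by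
  induction l with
  | nil => simp [pairQ_nil, qList]
  | cons a l ih =>
    rw [prod_phi_count_cons, List.map_cons, pairQ_cons, cop_qList_cons ρ, map_smul, ih hl.of_cons
      (fun c hc => hl0 c (List.mem_cons_of_mem _ hc)), smul_eq_mul, ← List.map_cons,
      List.count_map_of_injective _ _ Nat.cast_injective]
    · exact_mod_cast hl0 a List.mem_cons_self
    · rw [← List.map_cons, List.pairwise_map]
      exact hl.imp fun h => by exact_mod_cast h

theorem cop_qneg {σ : F} (hσ : σ ≠ 0) {b : ℕ} (hb : 0 < b) (N : ℤ) :
    cop ρ b (qneg σ N) = ((1 - σ⁻¹) * σ ^ b) • qneg (ρ * σ) (N - b) := by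
  have hmul : PowerSeries.rescale (algebraMap F (Lam F) σ) (expX fun r => ρ ^ r - 1) *
      (expX fun r => σ ^ r - 1) = expX fun r => (ρ * σ) ^ r - 1 := by
    rw [expX_rescale, ← expX_add]
    congr 1
    ext r
    simp only [Pi.add_apply]
    ring
  have hrhs : qneg (ρ * σ) (N - b) = ∑ᶠ k : ℤ, zcoeff (expX fun r => σ ^ r - 1) (N - k) *
      zcoeff (PowerSeries.rescale (algebraMap F (Lam F) σ) (expX fun r => ρ ^ r - 1)) (k - b) := by
    rw [qneg, ← hmul, mul_comm, zcoeff_mul, ← finsum_comp_equiv (Equiv.subRight (b : ℤ))]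
    simp only [Equiv.subRight_apply, sub_sub_sub_cancel_right]
  rw [hrhs, cop, qneg, vop_zcoeff_expX _ _ (by simp), smul_finsum]
  refine finsum_congr fun k => ?_
  rw [neg_add_eq_sub]
  rcases lt_or_ge k b with hk | hk
  · rw [zcoeff_of_neg _ (show k - (b : ℤ) < 0 by omega),
      zcoeff_of_neg _ (show k - (b : ℤ) < 0 by omega), zero_mul, mul_zero, smul_zero, smul_zero]
  · obtain ⟨j, rfl⟩ : ∃ j : ℕ, k = j + b := ⟨(k - b).toNat, by omega⟩
    rw [add_sub_cancel_right, zcoeff_natCast, zcoeff_natCast, PowerSeries.coeff_rescale,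
      ← map_pow, ← Algebra.smul_def, pairing_log 1 σ fun r => by rw [one_pow], zcoeff_geom,
      if_neg (by omega), if_neg (by omega), mul_smul_comm, smul_smul, mul_comm (zcoeff _ _)]
    congr 1
    obtain ⟨b, rfl⟩ : ∃ c, b = c + 1 := ⟨b - 1, by omega⟩
    rw [show ((j : ℤ) + (b + 1 : ℕ)).toNat = j + b + 1 by omega, Nat.add_sub_cancel]
    field_simp
    ring

theorem pairQ_qneg (hρ : ρ ≠ 0) (ν : List ℕ) (hν : ∀ a ∈ ν, 0 < a) (s : ℕ) :
    pairQ ρ (ν.map (↑)) (qneg (ρ ^ s) (ν.sum : ℕ)) =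
      ∏ i : Fin ν.length, (1 - ρ⁻¹ ^ (s + i)) * ρ ^ ((s + i) * ν.get i) := by
  induction ν generalizing s with
  | nil => simp [pairQ_nil, qneg_zero]
  | cons a ν ih =>
    rw [List.map_cons, pairQ_cons, cop_qneg ρ (pow_ne_zero s hρ) (hν a List.mem_cons_self),
      map_smul, ← pow_succ', List.sum_cons, Nat.cast_add, add_sub_cancel_left,
      ih (fun c hc => hν c (List.mem_cons_of_mem _ hc)), smul_eq_mul]
    refine Eq.trans ?_ (Fin.prod_univ_succ (n := ν.length) _).symm
    rw [← pow_mul]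
    simp only [inv_pow, Fin.val_zero, add_zero, List.get_cons_zero, Fin.val_succ]
    congr 1
    refine prod_congr rfl fun i _ => ?_
    rw [show s + 1 + (i : ℕ) = s + (i + 1) by ring]
    rfl

theorem cop_X {a : ℤ} (ha : 0 < a) (k : ℕ+) :
    cop ρ a (((k : ℕ) : ℚ) • MvPolynomial.X k) = qneg ρ (k - a) := by
  have hk : ((k : ℕ) : ℚ) ≠ 0 := by exact_mod_cast k.pos.ne'
  rw [map_rat_smul, ← mul_one (MvPolynomial.X k), cop_X_mul, cop_one_of_pos ρ ha, mul_zero,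
    zero_add, smul_smul, mul_one_div_cancel hk, one_smul, cop_one, neg_sub]

end Field

/-! ### Expansion of power sums at a generic parameter -/

section Grading

variable {K : Type*} [CommRing K] [Algebra ℚ K]

theorem isWeightedHomogeneous_coeff_expX (α : ℕ → K) (j : ℕ) :
    (PowerSeries.coeff j (expX α)).IsWeightedHomogeneous (fun r : ℕ+ => (r : ℕ)) j := by
  induction j using Nat.strong_induction_on with
  | _ j ih =>
    rcases Nat.eq_zero_or_pos j with rfl | hj
    · rw [coeff_zero_expX]
      exact MvPolynomial.isWeightedHomogeneous_one K _
    · have hsmul : ∀ (c : ℚ) (d : ℕ) (f : Lam K),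
          f.IsWeightedHomogeneous (fun r : ℕ+ => (r : ℕ)) d →
          (c • f).IsWeightedHomogeneous (fun r : ℕ+ => (r : ℕ)) d := fun c d f hf => by
        rw [← algebraMap_smul K c f]
        exact (MvPolynomial.weightedHomogeneousSubmodule K _ d).smul_mem _ hf
      have hj' : (j : ℚ) ≠ 0 := by positivity
      have key := newton_expX α j
      rw [← inv_smul_smul₀ hj' (PowerSeries.coeff j (expX α)), key]
      refine hsmul _ _ _ (MvPolynomial.IsWeightedHomogeneous.sum _ _ _ fun p hp => ?_)
      rw [HasAntidiagonal.mem_antidiagonal] at hp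
      rcases Nat.eq_zero_or_pos p.1 with h | h
      · rw [h, Nat.cast_zero, zero_smul, zero_mul]
        exact MvPolynomial.isWeightedHomogeneous_zero _ _ _
      · rw [← hp]
        refine MvPolynomial.IsWeightedHomogeneous.mul (hsmul _ _ _ ?_) (ih _ (by omega))
        generalize p.1 = r at h
        lift r to ℕ+ using h
        rw [tvar_natCast]
        exact (MvPolynomial.weightedHomogeneousSubmodule K _ _).smul_mem _
          (MvPolynomial.isWeightedHomogeneous_X K _ r)

theorem isWeightedHomogeneous_bop (ρ : K) {a : ℤ} {d e : ℕ} (h : (e : ℤ) = a + d) {f : Lam K}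
    (hf : f.IsWeightedHomogeneous (fun r : ℕ+ => (r : ℕ)) d) :
    (bop ρ a f).IsWeightedHomogeneous (fun r : ℕ+ => (r : ℕ)) e := by
  rw [← vertexOp_eq_bop, vertexOp]
  refine finsum_induction (fun g : Lam K => g.IsWeightedHomogeneous (fun r : ℕ+ => (r : ℕ)) e)
    (MvPolynomial.isWeightedHomogeneous_zero _ _ _) (fun _ _ h₁ h₂ => h₁.add h₂) fun j => ?_
  split_ifs with h0
  · have hl := lowers_annihilation j d f hf
    rcases lt_or_ge d j with hd | hd
    · rw [hl.1 hd, mul_zero]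
      exact MvPolynomial.isWeightedHomogeneous_zero _ _ _
    · rw [show e = (a + j).toNat + (d - j) by omega]
      exact (isWeightedHomogeneous_coeff_expX _ _).mul (hl.2 hd)
  · exact MvPolynomial.isWeightedHomogeneous_zero _ _ _

theorem isWeightedHomogeneous_qList (ρ : K) (l : List ℕ) :
    (qList ρ (l.map (↑))).IsWeightedHomogeneous (fun r : ℕ+ => (r : ℕ)) l.sum := by
  induction l with
  | nil => exact MvPolynomial.isWeightedHomogeneous_one K _
  | cons a l ih =>
    rw [List.map_cons, qList_cons]
    exact isWeightedHomogeneous_bop ρ (by simp) ih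

end Grading

section Monomials

variable {K : Type*} [CommRing K]

theorem exists_monomial_eq_prod_tvar (c : ℕ+ →₀ ℕ) :
    ∃ s : Multiset ℕ, (∀ i ∈ s, 0 < i) ∧ s.sum = Finsupp.weight (fun r : ℕ+ => (r : ℕ)) c ∧
      (s.map fun i : ℕ => tvar K i).prod = MvPolynomial.monomial c 1 := by
  induction c using Finsupp.induction_linear with
  | zero => exact ⟨0, by simp, by simp, by simp⟩
  | add c d hc hd =>
    obtain ⟨s, s1, s2, s3⟩ := hc
    obtain ⟨t, t1, t2, t3⟩ := hd
    refine ⟨s + t, fun i hi => ?_, ?_, ?_⟩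
    · exact (Multiset.mem_add.mp hi).elim (s1 i) (t1 i)
    · rw [Multiset.sum_add, s2, t2, map_add]
    · rw [Multiset.map_add, Multiset.prod_add, s3, t3, MvPolynomial.monomial_mul, one_mul]
  | single r n =>
    refine ⟨Multiset.replicate n r, fun i hi => ?_, ?_, ?_⟩
    · rw [Multiset.eq_of_mem_replicate hi]; exact r.pos
    · rw [Multiset.sum_replicate, Finsupp.weight_single]
    · rw [Multiset.map_replicate, Multiset.prod_replicate, tvar_natCast,
        MvPolynomial.X_pow_eq_monomial]

theorem mem_span_prod_tvar {k : ℕ} {f : Lam K}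
    (hf : f.IsWeightedHomogeneous (fun r : ℕ+ => (r : ℕ)) k) :
    f ∈ Submodule.span K (Set.range fun μ : Nat.Partition k =>
      (μ.parts.map fun i : ℕ => tvar K i).prod) := by
  rw [f.as_sum]
  refine Submodule.sum_mem _ fun c hc => ?_
  obtain ⟨s, s1, s2, s3⟩ := exists_monomial_eq_prod_tvar (K := K) c
  rw [hf (MvPolynomial.mem_support_iff.mp hc)] at s2
  rw [← mul_one (MvPolynomial.coeff c f), ← smul_eq_mul, ← MvPolynomial.smul_monomial, ← s3]
  exact Submodule.smul_mem _ _ (Submodule.subset_span ⟨⟨s, fun {i} => s1 i, s2⟩, rfl⟩)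

end Monomials

section Expansion

theorem pairwise_partsList {k : ℕ} (μ : Nat.Partition k) : (partsList μ).Pairwise (· ≥ ·) :=
  Multiset.pairwise_sort _ _

theorem coe_partsList {k : ℕ} (μ : Nat.Partition k) : (partsList μ : Multiset ℕ) = μ.parts :=
  Multiset.sort_eq _ _

theorem pos_of_mem_partsList {k : ℕ} (μ : Nat.Partition k) : ∀ a ∈ partsList μ, 0 < a :=
  fun a ha => μ.parts_pos (by rw [← coe_partsList]; exact ha)

theorem sum_partsList {k : ℕ} (μ : Nat.Partition k) : (partsList μ).sum = k := by
  rw [← Multiset.sum_coe, coe_partsList, μ.parts_sum]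

theorem partsList_injective {k : ℕ} : Function.Injective (partsList (k := k)) := by
  intro μ ν h
  apply Nat.Partition.ext
  rw [← coe_partsList, h, coe_partsList]

theorem ofFn_vec {k : ℕ} (μ : Nat.Partition k) : List.ofFn (vec μ) = (partsList μ).map (↑) := by
  conv_rhs => rw [← List.ofFn_get (partsList μ), List.map_ofFn]
  rfl

variable {F : Type*} [Field F]

theorem bFactor_eq {k : ℕ} (μ : Nat.Partition k) (x : F) :
    bFactor μ x = ∏ i ∈ (partsList μ).toFinset, phi ((partsList μ).count i) x := by
  rw [bFactor, ← coe_partsList, List.toFinset_coe]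
  simp only [Multiset.coe_count]

theorem phi_ne_zero {k j : ℕ} {x : F} (hx : ∀ i, 1 ≤ i → i ≤ k → x ^ i ≠ 1) (hj : j ≤ k) :
    phi j x ≠ 0 := by
  refine prod_ne_zero_iff.mpr fun i hi => ?_
  rw [mem_Icc] at hi
  exact sub_ne_zero.mpr (hx i hi.1 (by omega)).symm

theorem len_le {k : ℕ} (μ : Nat.Partition k) : len μ ≤ k := by
  have h := Multiset.card_nsmul_le_sum (s := μ.parts) (a := 1) fun _ hx => μ.parts_pos hx
  rwa [smul_eq_mul, mul_one, μ.parts_sum, ← coe_partsList, Multiset.coe_card] at h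

theorem count_le_len {k : ℕ} (μ : Nat.Partition k) (i : ℕ) : μ.parts.count i ≤ len μ := by
  have h : Multiset.card μ.parts = len μ := by rw [← coe_partsList, Multiset.coe_card]; rfl
  exact h ▸ Multiset.count_le_card i μ.parts

theorem bFactor_ne_zero {k : ℕ} (μ : Nat.Partition k) {x : F}
    (hx : ∀ i, 1 ≤ i → i ≤ k → x ^ i ≠ 1) : bFactor μ x ≠ 0 := by
  refine prod_ne_zero_iff.mpr fun i _ => phi_ne_zero hx ((count_le_len μ i).trans (len_le μ))

variable [Algebra ℚ F]

theorem pairQ_partsList (ρ : F) {k : ℕ} (μ ν : Nat.Partition k) :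
    pairQ ρ ((partsList ν).map (↑)) (qList ρ ((partsList μ).map (↑))) =
      if ν = μ then bFactor μ ρ else 0 := by
  split_ifs with h
  · subst h
    rw [pairQ_qList_self ρ _ (pairwise_partsList _) (pos_of_mem_partsList _), bFactor_eq]
  · have hp : ∀ κ : Nat.Partition k,
        ((partsList κ).map ((↑) : ℕ → ℤ)).Pairwise (· ≥ ·) := fun κ => by
      rw [List.pairwise_map]
      exact (pairwise_partsList κ).imp fun h => by exact_mod_cast h
    have h0 : ∀ κ : Nat.Partition k, ∀ a ∈ (partsList κ).map ((↑) : ℕ → ℤ), 0 < a := fun κ a ha => by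
      obtain ⟨b, hb, rfl⟩ := List.mem_map.mp ha
      exact_mod_cast pos_of_mem_partsList κ b hb
    exact pairQ_qList_of_ne ρ (hp _) (hp _) (h0 _) (h0 _) fun e =>
      h (partsList_injective (List.map_injective_iff.mpr Nat.cast_injective e))

/-- The polynomials `Q_μ`, `|μ| = k`, span the polynomials of weight `k`: by duality they are
linearly independent, and there are as many of them as monomials. -/
theorem mem_span_qList {ρ : F} {k : ℕ} (hρ : ∀ i, 1 ≤ i → i ≤ k → ρ ^ i ≠ 1) {f : Lam F}
    (hf : f.IsWeightedHomogeneous (fun r : ℕ+ => (r : ℕ)) k) :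
    f ∈ Submodule.span F (Set.range fun μ : Nat.Partition k =>
      qList ρ ((partsList μ).map (↑))) := by
  have hli : LinearIndependent F fun μ : Nat.Partition k => qList ρ ((partsList μ).map (↑)) := by
    rw [Fintype.linearIndependent_iff]
    intro g hg ν
    have := congrArg (pairQ ρ ((partsList ν).map (↑))) hg
    simp only [map_sum, map_smul, pairQ_partsList, smul_eq_mul, mul_ite, mul_zero, sum_ite_eq,
      mem_univ, if_true, map_zero] at this
    exact (mul_eq_zero.mp this).resolve_right (bFactor_ne_zero ν hρ)
  have hle : Submodule.span F (Set.range fun μ : Nat.Partition k =>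
      qList ρ ((partsList μ).map (↑))) ≤ Submodule.span F (Set.range fun μ : Nat.Partition k =>
      (μ.parts.map fun i : ℕ => tvar F i).prod) := by
    rw [Submodule.span_le]
    rintro _ ⟨μ, rfl⟩
    refine mem_span_prod_tvar ?_
    have := isWeightedHomogeneous_qList ρ (partsList μ)
    rwa [sum_partsList] at this
  have := FiniteDimensional.span_of_finite F (Set.finite_range fun μ : Nat.Partition k =>
      (μ.parts.map fun i : ℕ => tvar F i).prod)
  rw [Submodule.eq_of_le_of_finrank_le hle
    ((finrank_range_le_card _).trans (finrank_span_eq_card hli).ge)]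
  exact mem_span_prod_tvar hf

/-- The expansion of the power sum `k t_k` for a parameter that is not a root of unity. -/
theorem smul_X_eq_sum_qList {ρ : F} (hρ0 : ρ ≠ 0) (k : ℕ+)
    (hρ : ∀ i, 1 ≤ i → i ≤ (k : ℕ) → ρ ^ i ≠ 1) :
    ((k : ℕ) : ℚ) • MvPolynomial.X k = ∑ μ : Nat.Partition k,
      (ρ ^ nStat μ * phi (len μ - 1) ρ⁻¹ / bFactor μ ρ) • qList ρ ((partsList μ).map (↑)) := by
  have hom : (((k : ℕ) : ℚ) • MvPolynomial.X k : Lam F).IsWeightedHomogeneous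
      (fun r : ℕ+ => (r : ℕ)) (k : ℕ) := by
    rw [← algebraMap_smul F ((k : ℕ) : ℚ) (MvPolynomial.X k : Lam F)]
    exact (MvPolynomial.weightedHomogeneousSubmodule F _ _).smul_mem _
      (MvPolynomial.isWeightedHomogeneous_X F _ k)
  obtain ⟨a, ha⟩ := (Submodule.mem_span_range_iff_exists_fun F).mp (mem_span_qList hρ hom)
  rw [← ha]
  refine sum_congr rfl fun ν _ => ?_
  congr 1
  have h := congrArg (pairQ ρ ((partsList ν).map (↑))) ha
  simp only [map_sum, map_smul, pairQ_partsList, smul_eq_mul, mul_ite, mul_zero, sum_ite_eq,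
    mem_univ, if_true] at h
  rw [eq_div_iff (bFactor_ne_zero ν hρ), h]
  change _ = ρ ^ (∑ i : Fin (partsList ν).length, (i : ℕ) * (partsList ν).get i) *
    phi ((partsList ν).length - 1) ρ⁻¹
  have hpos := pos_of_mem_partsList ν
  have hsum := sum_partsList ν
  revert hpos hsum
  generalize partsList ν = l
  intro hpos hsum
  cases l with
  | nil => exact absurd hsum k.pos.ne
  | cons b l =>
    have hb : ((k : ℕ) : ℤ) - b = (l.sum : ℕ) := by rw [← hsum, List.sum_cons]; push_cast; ring
    have key := pairQ_qneg ρ hρ0 l (fun c hc => hpos c (List.mem_cons_of_mem _ hc)) 1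
    rw [pow_one, prod_get_eq] at key
    rw [List.map_cons, pairQ_cons, cop_X ρ (by exact_mod_cast hpos b List.mem_cons_self), hb, key]
    have hs : ∑ i : Fin (b :: l).length, (i : ℕ) * (b :: l).get i =
        ∑ i : Fin l.length, ((i : ℕ) + 1) * l.get i := by
      refine (Fin.sum_univ_succ (n := l.length) _).trans ?_
      rw [Fin.val_zero, zero_mul, zero_add]
      rfl
    rw [hs]
    rfl

end Expansion

/-! ### Specialization to a root of unity -/

section Specialization

open Polynomial

section PolynomialDependence

variable {K : Type*} [CommRing K]

/-- The family `F z` of polynomials in the `t_r` depends polynomially on the parameter `z`. -/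
def PolyDep (F : K → Lam K) : Prop :=
  ∃ P : Polynomial (Lam K), ∀ z, F z = P.eval (MvPolynomial.C z)

theorem PolyDep.const (f : Lam K) : PolyDep fun _ => f := ⟨Polynomial.C f, fun _ => by simp⟩

theorem PolyDep.add {F G : K → Lam K} (hF : PolyDep F) (hG : PolyDep G) :
    PolyDep fun z => F z + G z := by
  obtain ⟨P, hP⟩ := hF
  obtain ⟨R, hR⟩ := hG
  exact ⟨P + R, fun z => by simp only [Polynomial.eval_add, hP, hR]⟩

theorem PolyDep.mul {F G : K → Lam K} (hF : PolyDep F) (hG : PolyDep G) :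
    PolyDep fun z => F z * G z := by
  obtain ⟨P, hP⟩ := hF
  obtain ⟨R, hR⟩ := hG
  exact ⟨P * R, fun z => by simp only [Polynomial.eval_mul, hP, hR]⟩

variable [Algebra ℚ K]

theorem PolyDep.qpos (m : ℤ) : PolyDep fun z : K => qpos z m := by
  rcases lt_or_ge m 0 with hm | hm
  · simp only [qpos_of_neg _ hm]
    exact PolyDep.const 0
  · lift m to ℕ using hm
    refine ⟨PowerSeries.coeff m (expSeries (PowerSeries.mk fun r =>
      (1 - Polynomial.X ^ r) * Polynomial.C (tvar K r))), fun z => ?_⟩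
    change HallLittlewood.qpos z m = _
    rw [← Polynomial.coe_evalRingHom, ← PowerSeries.coeff_map, expSeries_map,
      show HallLittlewood.qpos z m = PowerSeries.coeff m (expX fun r => 1 - z ^ r) from
        zcoeff_natCast _ _, expX]
    congr 2
    ext1 r
    simp [MvPolynomial.smul_eq_C_mul]

theorem PolyDep.bop_const (a : ℤ) (f : Lam K) : PolyDep fun z : K => bop z a f := by
  simp only [bop, vop_apply]
  induction shift K (fun r => -(1 / (r : ℚ))) f using Polynomial.induction_on' with
  | add p q hp hq => simpa only [map_add] using hp.add hq
  | monomial j x =>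
    simp only [contract_monomial]
    exact (PolyDep.qpos _).mul (PolyDep.const x)

theorem PolyDep.bop (a : ℤ) {F : K → Lam K} (hF : PolyDep F) : PolyDep fun z => bop z a (F z) := by
  obtain ⟨P, hP⟩ := hF
  simp only [hP]
  clear hP F
  induction P using Polynomial.induction_on' with
  | add p q hp hq => simpa only [Polynomial.eval_add, map_add] using hp.add hq
  | monomial j x =>
    have h : ∀ z : K, HallLittlewood.bop z a ((Polynomial.monomial j x).eval (MvPolynomial.C z)) =
        (Polynomial.X ^ j : Polynomial (Lam K)).eval (MvPolynomial.C z) *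
          HallLittlewood.bop z a x := by
      intro z
      rw [Polynomial.eval_monomial, Polynomial.eval_pow, Polynomial.eval_X, mul_comm, ← map_pow,
        ← MvPolynomial.smul_eq_C_mul, map_smul, MvPolynomial.smul_eq_C_mul]
    simp only [h]
    exact PolyDep.mul ⟨_, fun _ => rfl⟩ (PolyDep.bop_const a x)

theorem PolyDep.qList (l : List ℤ) : PolyDep fun z : K => qList z l := by
  induction l with
  | nil => exact PolyDep.const 1
  | cons a l ih => exact ih.bop a

theorem PolyDep.continuous_coeff {F : ℂ → Lam ℂ} (hF : PolyDep F) (d : ℕ+ →₀ ℕ) :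
    Continuous fun z => MvPolynomial.coeff d (F z) := by
  obtain ⟨P, hP⟩ := hF
  simp only [hP, Polynomial.eval_eq_sum_range, MvPolynomial.coeff_sum, ← map_pow,
    mul_comm _ (MvPolynomial.C _), MvPolynomial.coeff_C_mul]
  fun_prop

end PolynomialDependence

section Poles

/-- `φ_k` as a polynomial. -/
def phiPoly (k : ℕ) : ℂ[X] := ∏ i ∈ Icc 1 k, (1 - X ^ i)

theorem eval_phiPoly (k : ℕ) (z : ℂ) : (phiPoly k).eval z = phi k z := by
  simp [phiPoly, phi, Polynomial.eval_prod]

theorem algebraMap_phiPoly (k : ℕ) :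
    algebraMap ℂ[X] (RatFunc ℂ) (phiPoly k) = phi k (RatFunc.X : RatFunc ℂ) := by
  simp [phiPoly, phi]

theorem phi_inv {F : Type*} [Field F] {x : F} (hx : x ≠ 0) (k : ℕ) :
    phi k x⁻¹ = phi k x / ∏ i ∈ Icc 1 k, -x ^ i := by
  rw [phi, phi, ← prod_div_distrib]
  refine prod_congr rfl fun i _ => ?_
  have := pow_ne_zero i hx
  rw [inv_pow]
  field_simp
  ring

/-- The zero of `φ_s` at a primitive `n`-th root of unity has order `⌊s / n⌋`. -/
theorem exists_phiPoly_eq {n : ℕ} {ξ : ℂ} (hξ : IsPrimitiveRoot ξ n) (hn : n ≠ 0) (s : ℕ) :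
    ∃ G : ℂ[X], phiPoly s = (X - C ξ) ^ (s / n) * G ∧ G.eval ξ ≠ 0 := by
  induction s with
  | zero => exact ⟨1, by simp [phiPoly], by simp⟩
  | succ s ih =>
    obtain ⟨G, hG, hG0⟩ := ih
    have hs : phiPoly (s + 1) = phiPoly s * (1 - X ^ (s + 1)) := by
      rw [phiPoly, phiPoly, prod_Icc_succ_top (by omega)]
    rw [hs, hG, Nat.succ_div]
    split_ifs with hd
    · have hroot : (1 - X ^ (s + 1) : ℂ[X]).IsRoot ξ := by
        simp [(hξ.pow_eq_one_iff_dvd _).mpr hd]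
      obtain ⟨H, hH⟩ := Polynomial.dvd_iff_isRoot.mpr hroot
      refine ⟨G * H, by rw [hH]; ring, ?_⟩
      rw [Polynomial.eval_mul]
      refine mul_ne_zero hG0 fun h0 => ?_
      have hder := congrArg (fun p => (Polynomial.derivative p).eval ξ) hH
      simp only [Polynomial.derivative_mul, Polynomial.derivative_sub, Polynomial.derivative_one,
        Polynomial.derivative_X_pow, Polynomial.derivative_X, Polynomial.derivative_C,
        Polynomial.eval_add, Polynomial.eval_mul, Polynomial.eval_sub, Polynomial.eval_X,
        Polynomial.eval_C, h0, Polynomial.eval_pow, Polynomial.eval_one, Polynomial.eval_zero] at hder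
      have hne : ξ ≠ 0 := hξ.ne_zero hn
      have : ((s + 1 : ℕ) : ℂ) * ξ ^ s ≠ 0 :=
        mul_ne_zero (Nat.cast_ne_zero.mpr (Nat.succ_ne_zero s)) (pow_ne_zero s hne)
      apply this
      simpa using hder
    · refine ⟨G * (1 - X ^ (s + 1)), by rw [add_zero, mul_assoc], ?_⟩
      rw [Polynomial.eval_mul]
      refine mul_ne_zero hG0 ?_
      simp only [Polynomial.eval_sub, Polynomial.eval_one, Polynomial.eval_pow, Polynomial.eval_X]
      exact sub_ne_zero.mpr fun h => hd ((hξ.pow_eq_one_iff_dvd _).mp h.symm)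

theorem sum_count_div_le {n k : ℕ} (μ : Nat.Partition k) (hk : ¬ n ∣ k) :
    ∑ i ∈ μ.parts.toFinset, μ.parts.count i / n ≤ (len μ - 1) / n := by
  rcases Nat.eq_zero_or_pos n with rfl | hn
  · simp
  have hlen : ∑ i ∈ μ.parts.toFinset, μ.parts.count i = len μ := by
    rw [Multiset.toFinset_sum_count_eq, ← coe_partsList, Multiset.coe_card]; rfl
  have hsum : ∑ i ∈ μ.parts.toFinset, μ.parts.count i * i = k := by
    refine Eq.trans ?_ ((Finset.sum_multiset_count μ.parts).symm.trans μ.parts_sum)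
    simp only [smul_eq_mul]
  have hle : ∀ i ∈ μ.parts.toFinset, μ.parts.count i / n * n ≤ μ.parts.count i :=
    fun i _ => Nat.div_mul_le_self _ _
  rw [Nat.le_div_iff_mul_le hn, sum_mul]
  have h1 := sum_le_sum hle
  rw [hlen] at h1
  by_contra hlt
  -- Otherwise all the multiplicities are divisible by `n`, and so is `k`.
  have heq : ∑ i ∈ μ.parts.toFinset, μ.parts.count i / n * n =
      ∑ i ∈ μ.parts.toFinset, μ.parts.count i := by omega
  refine hk ?_
  rw [← hsum]
  refine dvd_sum fun i hi => Dvd.dvd.mul_right ?_ i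
  rw [← (sum_eq_sum_iff_of_le hle).mp heq i hi]
  exact dvd_mul_left _ _

variable {k : ℕ} (μ : Nat.Partition k)

/-- A numerator of `c_μ`, not necessarily coprime to `cDenom μ`. -/
def cNum : ℂ[X] := X ^ nStat μ * phiPoly (len μ - 1)

/-- A denominator of `c_μ`. -/
def cDenom : ℂ[X] :=
  (∏ i ∈ Icc 1 (len μ - 1), -X ^ i) * ∏ i ∈ μ.parts.toFinset, phiPoly (μ.parts.count i)

theorem phiPoly_ne_zero (j : ℕ) : phiPoly j ≠ 0 := by
  refine prod_ne_zero_iff.mpr fun i hi h => ?_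
  rw [mem_Icc] at hi
  have := congrArg (Polynomial.eval 0) h
  simp [show i ≠ 0 by omega] at this

theorem cDenom_ne_zero : cDenom μ ≠ 0 :=
  mul_ne_zero (prod_ne_zero_iff.mpr fun i _ => neg_ne_zero.mpr (pow_ne_zero i X_ne_zero))
    (prod_ne_zero_iff.mpr fun _ _ => phiPoly_ne_zero _)

theorem cRat_eq : cRat μ = algebraMap ℂ[X] (RatFunc ℂ) (cNum μ) / algebraMap _ _ (cDenom μ) := by
  rw [cRat, phi_inv RatFunc.X_ne_zero, bFactor, cNum, cDenom]
  simp only [map_mul, map_pow, map_prod, map_neg, RatFunc.algebraMap_X, algebraMap_phiPoly]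
  rw [mul_div_assoc', div_div]

theorem c_eq_of_eval_cDenom_ne_zero {z : ℂ} (hz : (cDenom μ).eval z ≠ 0) :
    c μ z = (cNum μ).eval z / (cDenom μ).eval z := by
  have h := (RatFunc.num_mul_eq_mul_denom_iff (cDenom_ne_zero μ)).mpr (cRat_eq μ)
  have hd : (cRat μ).denom.eval z ≠ 0 := fun h0 => hz <| by
    obtain ⟨p, hp⟩ := (RatFunc.denom_dvd (cDenom_ne_zero μ)).mpr ⟨_, cRat_eq μ⟩
    rw [hp, Polynomial.eval_mul, h0, zero_mul]
  rw [c, RatFunc.eval, Polynomial.eval₂_id, Polynomial.eval₂_id, div_eq_div_iff hd hz,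
    ← Polynomial.eval_mul, h, Polynomial.eval_mul]

theorem c_eq {z : ℂ} (hz : z ≠ 0) (hz' : ∀ i, 1 ≤ i → i ≤ k → z ^ i ≠ 1) :
    c μ z = z ^ nStat μ * phi (len μ - 1) z⁻¹ / bFactor μ z := by
  have e : (cDenom μ).eval z = (∏ i ∈ Icc 1 (len μ - 1), -z ^ i) * bFactor μ z := by
    simp only [cDenom, Polynomial.eval_mul, Polynomial.eval_prod, Polynomial.eval_neg,
      Polynomial.eval_pow, Polynomial.eval_X, eval_phiPoly, bFactor]
  have h1 : (∏ i ∈ Icc 1 (len μ - 1), -z ^ i) ≠ 0 :=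
    prod_ne_zero_iff.mpr fun i _ => neg_ne_zero.mpr (pow_ne_zero i hz)
  rw [c_eq_of_eval_cDenom_ne_zero μ (by rw [e]; exact mul_ne_zero h1 (bFactor_ne_zero μ hz')), e,
    cNum, Polynomial.eval_mul, Polynomial.eval_pow, Polynomial.eval_X, eval_phiPoly, phi_inv hz,
    mul_div_assoc', div_div]

/-- The rational function `c_μ` has no pole at a primitive `n`-th root of unity if `n ∤ |μ|`. -/
theorem continuousAt_c {n : ℕ} {ξ : ℂ} (hξ : IsPrimitiveRoot ξ n) (hn : n ≠ 0) (hk : ¬ n ∣ k) :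
    ContinuousAt (c μ) ξ := by
  have hd : (cRat μ).denom.eval ξ ≠ 0 := by
    choose G hG hG0 using exists_phiPoly_eq hξ hn
    obtain ⟨e, he⟩ := Nat.exists_eq_add_of_le (sum_count_div_le μ hk)
    set D : ℂ[X] := (∏ i ∈ Icc 1 (len μ - 1), -X ^ i) *
      ∏ i ∈ μ.parts.toFinset, G (μ.parts.count i) with hD
    have hDξ : D.eval ξ ≠ 0 := by
      rw [hD, Polynomial.eval_mul, Polynomial.eval_prod, Polynomial.eval_prod]
      refine mul_ne_zero (prod_ne_zero_iff.mpr fun i _ => ?_)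
        (prod_ne_zero_iff.mpr fun i _ => hG0 _)
      simp [hξ.ne_zero hn]
    have hD0 : D ≠ 0 := fun h => hDξ (by rw [h, Polynomial.eval_zero])
    set s := ∑ i ∈ μ.parts.toFinset, μ.parts.count i / n with hs
    have h1 : cDenom μ = (X - C ξ) ^ s * D := by
      rw [cDenom, prod_congr rfl fun i _ => hG (μ.parts.count i), prod_mul_distrib,
        prod_pow_eq_pow_sum, hD]
      ring
    have h2 : cNum μ = (X - C ξ) ^ s * (X ^ nStat μ * (X - C ξ) ^ e * G (len μ - 1)) := by
      rw [cNum, hG, he, pow_add]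
      ring
    have hdvd : (cRat μ).denom ∣ D := by
      refine (RatFunc.denom_dvd hD0).mpr ⟨X ^ nStat μ * (X - C ξ) ^ e * G (len μ - 1), ?_⟩
      rw [cRat_eq, h1, h2, map_mul, map_mul _ _ D, mul_div_mul_left]
      exact RatFunc.algebraMap_ne_zero (pow_ne_zero _ (X_sub_C_ne_zero ξ))
    obtain ⟨p, hp⟩ := hdvd
    intro h0
    exact hDξ (by rw [hp, Polynomial.eval_mul, h0, zero_mul])
  have hc : c μ = fun z => (cRat μ).num.eval z / (cRat μ).denom.eval z := by
    ext z
    rw [c, RatFunc.eval, Polynomial.eval₂_id, Polynomial.eval₂_id]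
  rw [hc]
  exact (Polynomial.continuous _).continuousAt.div (Polynomial.continuous _).continuousAt hd

end Poles

/-- The expansion of the power sum `k t_k` at a primitive `n`-th root of unity, for `n ∤ k`. It is the
limit of the expansions at the points nearby. -/
theorem smul_tvar_eq_sum_qList {n k : ℕ} {ξ : ℂ} (hξ : IsPrimitiveRoot ξ n) (hn : n ≠ 0)
    (hk : ¬ n ∣ k) :
    (k : ℂ) • tvar ℂ k = ∑ μ : Nat.Partition k, c μ ξ • qList ξ ((partsList μ).map (↑)) := by
  have hk0 : 0 < k := Nat.pos_of_ne_zero fun h => hk (h ▸ dvd_zero n)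
  have hgen : ∀ᶠ z in nhdsWithin ξ {ξ}ᶜ, z ≠ 0 ∧ ∀ i, 1 ≤ i → i ≤ k → z ^ i ≠ 1 := by
    have hfin : {z : ℂ | (X * ∏ i ∈ Icc 1 k, (X ^ i - 1) : ℂ[X]).IsRoot z}.Finite := by
      refine Polynomial.finite_setOfPred_isRoot (mul_ne_zero X_ne_zero (prod_ne_zero_iff.mpr ?_))
      intro i hi
      rw [mem_Icc] at hi
      exact Polynomial.X_pow_sub_C_ne_zero (by omega) 1
    have := (hfin.subset (Set.sdiff_subset (t := {ξ}))).isClosed.isOpen_compl.mem_nhds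
      (show ξ ∈ _ by simp)
    filter_upwards [nhdsWithin_le_nhds this, self_mem_nhdsWithin] with z hz hzξ
    have hz' : ¬ (X * ∏ i ∈ Icc 1 k, (X ^ i - 1) : ℂ[X]).IsRoot z := fun h => hz ⟨h, hzξ⟩
    rw [Polynomial.IsRoot.def, Polynomial.eval_mul, Polynomial.eval_prod, mul_eq_zero, not_or,
      prod_eq_zero_iff] at hz'
    refine ⟨by simpa using hz'.1, fun i h1 h2 h => hz'.2 ⟨i, mem_Icc.mpr ⟨h1, h2⟩, by simp [h]⟩⟩
  lift k to ℕ+ using hk0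
  have hsmul : ((k : ℕ) : ℂ) • tvar ℂ (k : ℕ) = ((k : ℕ) : ℚ) • tvar ℂ (k : ℕ) := by
    rw [Nat.cast_smul_eq_nsmul, Nat.cast_smul_eq_nsmul]
  refine MvPolynomial.ext _ _ fun d => ?_
  rw [MvPolynomial.coeff_sum]
  have hlim : Filter.Tendsto (fun z => ∑ μ : Nat.Partition k,
      MvPolynomial.coeff d (c μ z • qList z ((partsList μ).map (↑)))) (nhdsWithin ξ {ξ}ᶜ)
      (nhds (∑ μ : Nat.Partition k,
        MvPolynomial.coeff d (c μ ξ • qList ξ ((partsList μ).map (↑))))) := by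
    refine tendsto_finsetSum _ fun μ _ => ?_
    simp only [MvPolynomial.coeff_smul, smul_eq_mul]
    exact ((continuousAt_c μ hξ hn hk).mul
      ((PolyDep.qList _).continuous_coeff d).continuousAt).tendsto.mono_left nhdsWithin_le_nhds
  refine tendsto_nhds_unique (tendsto_const_nhds.congr' ?_) hlim
  filter_upwards [hgen] with z hz
  rw [← MvPolynomial.coeff_sum, hsmul]
  congr 1
  have := smul_X_eq_sum_qList hz.1 k hz.2
  rw [tvar_natCast]
  refine this.trans (sum_congr rfl fun μ _ => ?_)
  rw [c_eq μ hz.1 hz.2]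

end Specialization

/-! ### The commutator of `L_{-m}` and `B_a` -/

section Derivative

variable {K : Type*} [CommRing K]

theorem dt_X_mul_int (r : ℤ) (k : ℕ+) (f : Lam K) :
    dt K r (MvPolynomial.X k * f) =
      MvPolynomial.X k * dt K r f + if r = k then f else 0 := by
  rcases le_or_gt r 0 with hr | hr
  · rw [dt_of_nonpos hr, if_neg (by have := k.pos; omega)]; simp
  · lift r to ℕ using hr.le
    rw [dt_X_mul]
    simp only [Nat.cast_inj]

variable [Algebra ℚ K]

theorem pderiv_coeff_expX (α : ℕ → K) (k : ℕ+) (j : ℕ) :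
    MvPolynomial.pderiv k (PowerSeries.coeff j (expX α)) =
      if (k : ℕ) ≤ j then α k • PowerSeries.coeff (j - k) (expX α) else 0 := by
  set q := expX α
  set a : PowerSeries (Lam K) := PowerSeries.mk fun r => α r • tvar K r with ha
  have hq : euler q = euler a * q :=
    euler_expSeries (by simp [tvar_zero]) fun _ _ => Commute.all _ _
  let d : PowerSeries (Lam K) → PowerSeries (Lam K) := fun f =>
    PowerSeries.mk fun j => MvPolynomial.pderiv k (PowerSeries.coeff j f)
  have d_mul : ∀ f g, d (f * g) = d f * g + f * d g := by
    intro f g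
    ext1 i
    simp only [d, PowerSeries.coeff_mk, map_add, PowerSeries.coeff_mul, map_sum,
      Derivation.leibniz, smul_eq_mul, ← sum_add_distrib]
    exact sum_congr rfl fun p _ => by ring
  have d_euler : ∀ f, d (euler f) = euler (d f) := by
    intro f
    ext1 i
    simp only [d, PowerSeries.coeff_mk, coeff_euler, map_rat_smul]
  have d_a : d a = PowerSeries.C (MvPolynomial.C (α k)) * PowerSeries.X ^ (k : ℕ) := by
    ext1 i
    rw [PowerSeries.coeff_C_mul_X_pow, PowerSeries.coeff_mk, ha, PowerSeries.coeff_mk]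
    rcases Nat.eq_zero_or_pos i with rfl | hi
    · rw [if_neg k.pos.ne]; simp [tvar_zero]
    · lift i to ℕ+ using hi
      rw [tvar_natCast, Derivation.map_smul, MvPolynomial.pderiv_X, MvPolynomial.smul_eq_C_mul]
      simp only [PNat.coe_inj]
      split_ifs with h
      · subst h; simp
      · rw [Pi.single_eq_of_ne (Ne.symm h).symm, mul_zero]
  -- Both sides solve the same inhomogeneous equation.
  have key : d q - d a * q = 0 := by
    refine eq_of_euler (b := euler a) (by simp [coeff_euler]) ?_ ?_ ?_
    · rw [map_sub, PowerSeries.coeff_mk, show PowerSeries.coeff 0 q = 1 from coeff_zero_expX α,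
        d_a]
      simp [k.pos.ne']
    · have h1 := congrArg d hq
      rw [d_mul, d_euler, d_euler] at h1
      have h2 : euler (d q - d a * q) = euler (d q) - euler (d a * q) := by
        ext1 i; simp [coeff_euler, smul_sub]
      rw [h2, euler_mul, h1, hq]
      ring
    · ext1 i; simp [coeff_euler]
  have := congrArg (PowerSeries.coeff j) (sub_eq_zero.mp key)
  rw [PowerSeries.coeff_mk, d_a, mul_assoc, PowerSeries.coeff_C_mul,
    PowerSeries.coeff_X_pow_mul'] at this
  rw [this, mul_ite, mul_zero]
  split_ifs
  · rw [MvPolynomial.smul_eq_C_mul]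
  · rfl

theorem dt_qpos (σ : K) {k : ℕ} (hk : 0 < k) (a : ℤ) :
    dt K k (qpos σ a) = (1 - σ ^ k) • qpos σ (a - k) := by
  lift k to ℕ+ using hk
  rw [dt_apply_of_pos]
  rcases lt_or_ge a 0 with ha | ha
  · rw [qpos_of_neg σ ha, qpos_of_neg σ (by omega), map_zero, smul_zero]
  · lift a to ℕ using ha
    rw [qpos, zcoeff_natCast, pderiv_coeff_expX]
    split_ifs with h
    · rw [qpos, ← Nat.cast_sub h, zcoeff_natCast]
    · rw [qpos_of_neg σ (by omega), smul_zero]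

end Derivative

section PowerSum

/-- The power sum `p_k = k t_k`. -/
def psum (k : ℕ) : Lam ℂ := (k : ℂ) • tvar ℂ k

theorem psum_natCast (k : ℕ+) : psum k = ((k : ℕ) : ℂ) • MvPolynomial.X k := by
  rw [psum, tvar_natCast]

theorem bop_psum_mul (ρ : ℂ) (a : ℤ) {k : ℕ} (hk : 0 < k) (f : Lam ℂ) :
    bop ρ a (psum k * f) = psum k * bop ρ a f - bop ρ (a + k) f := by
  lift k to ℕ+ using hk
  have hk : ((k : ℕ) : ℂ) ≠ 0 := by exact_mod_cast k.pos.ne'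
  have h : (1 / ((k : ℕ) : ℚ)) • bop ρ (a + k) f = (((k : ℕ) : ℂ)⁻¹) • bop ρ (a + k) f := by
    rw [← algebraMap_smul ℂ]; simp
  rw [psum_natCast, smul_mul_assoc, map_smul, bop_X_mul, h, smul_sub, smul_smul,
    mul_inv_cancel₀ hk, one_smul, smul_mul_assoc]

theorem newton_qpos (ρ : ℂ) (M : ℤ) :
    (M : ℂ) • qpos ρ M = ∑ᶠ k : ℕ, (1 - ρ ^ k) • (psum k * qpos ρ (M - k)) := by
  rcases lt_or_ge M 0 with h | h
  · rw [qpos_of_neg ρ h, smul_zero, finsum_eq_zero_of_forall_eq_zero]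
    intro k
    rw [qpos_of_neg ρ (by omega), mul_zero, smul_zero]
  · lift M to ℕ using h
    have key := newton_expX (fun r => 1 - ρ ^ r) M
    rw [finsum_eq_sum_of_support_subset (s := range (M + 1))]
    · rw [Finset.Nat.sum_antidiagonal_eq_sum_range_succ_mk] at key
      rw [qpos, zcoeff_natCast]
      have h1 : ((M : ℤ) : ℂ) • PowerSeries.coeff M (expX fun r => 1 - ρ ^ r) =
          (M : ℚ) • PowerSeries.coeff M (expX fun r => 1 - ρ ^ r) := by
        rw [Int.cast_natCast, Nat.cast_smul_eq_nsmul, Nat.cast_smul_eq_nsmul]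
      rw [h1, key]
      refine sum_congr rfl fun k hk => ?_
      rw [mem_range] at hk
      rw [qpos, ← Nat.cast_sub (by omega), zcoeff_natCast, psum, Nat.cast_smul_eq_nsmul,
        Nat.cast_smul_eq_nsmul, smul_comm, smul_mul_assoc]
    · intro k hk
      rw [Function.mem_support] at hk
      rw [coe_range, Set.mem_Iio]
      by_contra hlt
      exact hk (by rw [qpos_of_neg ρ (by omega), mul_zero, smul_zero])

end PowerSum

section Indices

theorem mem_idx {n N k : ℕ} : k ∈ idx n N ↔ k < N ∧ ¬ n ∣ k := by
  rw [idx, mem_filter, mem_Icc]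
  constructor
  · rintro ⟨h1, h2⟩; exact ⟨by omega, h2⟩
  · rintro ⟨h1, h2⟩
    have : k ≠ 0 := fun h => h2 (h ▸ dvd_zero n)
    exact ⟨by omega, h2⟩

theorem pos_of_not_dvd {n k : ℕ} (h : ¬ n ∣ k) : 0 < k :=
  Nat.pos_of_ne_zero fun h0 => h (h0 ▸ dvd_zero n)

theorem sum_idx_reflect {M : Type*} [AddCommMonoid M] (n m : ℕ) (F : ℕ → ℕ → M) :
    ∑ k ∈ idx n (m * n), F k (m * n - k) = ∑ k ∈ idx n (m * n), F (m * n - k) k := by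
  have hmem : ∀ k ∈ idx n (m * n), m * n - k ∈ idx n (m * n) := by
    intro k hk
    rw [mem_idx] at hk ⊢
    have := pos_of_not_dvd hk.2
    refine ⟨by omega, fun hd => hk.2 ?_⟩
    exact (Nat.dvd_sub_iff_right hk.1.le (dvd_mul_left n m)).mp hd
  refine sum_bij' (fun k _ => m * n - k) (fun k _ => m * n - k) hmem hmem ?_ ?_ ?_
  · intro k hk; rw [mem_idx] at hk; omega
  · intro k hk; rw [mem_idx] at hk; omega
  · intro k hk; rw [mem_idx] at hk; rw [Nat.sub_sub_self hk.1.le]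

/-- The indices `0 ≤ k < m n` missing from `idx n (m * n)` are the `m` multiples of `n`, at which `g`
is `1`. -/
theorem sum_idx_add {n : ℕ} (hn : 0 < n) (m : ℕ) (g : ℕ → ℂ) (hg : ∀ k, n ∣ k → g k = 1) :
    ∑ k ∈ idx n (m * n), g k + m = ∑ k ∈ range (m * n), g k := by
  have h1 : idx n (m * n) = (range (m * n)).filter fun k => ¬ n ∣ k := by
    ext k; rw [mem_idx, mem_filter, mem_range]
  have h2 : (range (m * n)).filter (fun k => n ∣ k) = (range m).image fun i => i * n := by
    ext k
    simp only [mem_filter, mem_range, mem_image]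
    constructor
    · rintro ⟨hk, j, rfl⟩
      exact ⟨j, by rw [mul_comm n] at hk; exact lt_of_mul_lt_mul_right hk hn.le, mul_comm _ _⟩
    · rintro ⟨i, hi, rfl⟩
      exact ⟨Nat.mul_lt_mul_of_pos_right hi hn, dvd_mul_left _ _⟩
  rw [← sum_filter_add_sum_filter_not (range (m * n)) (fun k => n ∣ k), ← h1, h2,
    sum_image fun i _ j _ h => Nat.eq_of_mul_eq_mul_right hn h,
    sum_congr rfl fun i _ => hg (i * n) (dvd_mul_left n i)]
  simp [add_comm]

theorem card_idx {n : ℕ} (hn : 0 < n) (m : ℕ) : ((idx n (m * n)).card : ℂ) = m * (n - 1) := by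
  have := sum_idx_add hn m (fun _ => 1) fun _ _ => rfl
  simp only [sum_const, card_range, nsmul_eq_mul, mul_one, Nat.cast_mul] at this
  linear_combination this

theorem sum_pow_idx {n : ℕ} (hn : 2 ≤ n) {ξ : ℂ} (hξ : IsPrimitiveRoot ξ n) (m : ℕ) :
    ∑ k ∈ idx n (m * n), ξ ^ k = -m := by
  have h := sum_idx_add (by omega) m (fun k => ξ ^ k) fun k hk => (hξ.pow_eq_one_iff_dvd k).mpr hk
  have h1 : ξ ≠ 1 := hξ.ne_one (by omega)
  rw [geom_sum_eq h1, (hξ.pow_eq_one_iff_dvd _).mpr (dvd_mul_left n m), sub_self, zero_div] at h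
  linear_combination h

end Indices

section Virasoro

/-- The first part of the operator `L_{-m}^{(n)}`; the condition `n ∤ k` implies `k ≥ 1`. -/
def virasoroDiff (n m : ℕ) (f : Lam ℂ) : Lam ℂ :=
  ∑ᶠ k : ℕ, if ¬ n ∣ k then psum k * dt ℂ (k - (m * n : ℕ)) f else 0

theorem virasoroDiff_term (n m : ℕ) (f : Lam ℂ) (k : ℕ) :
    (if 1 ≤ k ∧ ¬ n ∣ k then (k : ℂ) • (tvar ℂ k * dt ℂ (k + n * (-(m : ℤ))) f) else 0) =
      if ¬ n ∣ k then psum k * dt ℂ (k - (m * n : ℕ)) f else 0 := by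
  have h : (1 ≤ k ∧ ¬ n ∣ k) ↔ ¬ n ∣ k := ⟨fun h => h.2, fun h => ⟨pos_of_not_dvd h, h⟩⟩
  rw [if_congr h rfl rfl, psum, smul_mul_assoc,
    show (k : ℤ) + n * (-(m : ℤ)) = k - (m * n : ℕ) by push_cast; ring]

theorem finite_virasoroDiff (n m : ℕ) (f : Lam ℂ) : (Function.support fun k : ℕ =>
    if ¬ n ∣ k then psum k * dt ℂ (k - (m * n : ℕ)) f else 0).Finite := by
  have := finite_virasoro n (-(m : ℤ)) f
  simpa only [virasoroDiff_term] using this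

theorem virasoro_neg (n : ℕ) {m : ℕ} (hm : 1 ≤ m) (f : Lam ℂ) :
    virasoro n (-(m : ℤ)) f = virasoroDiff n m f +
      (1 / 2 : ℂ) • ∑ k ∈ idx n (m * n), psum k * psum (m * n - k) * f := by
  have h2 : Icc (1 : ℤ) (-(m : ℤ) * n - 1) = ∅ := by
    apply Icc_eq_empty
    have : (0 : ℤ) ≤ (m : ℤ) * n := by positivity
    rw [neg_mul]; omega
  have h3 : ∑ k ∈ (Icc (1 : ℤ) (-(-(m : ℤ)) * n - 1)).filter (fun k => ¬ (n : ℤ) ∣ k),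
      ((k : ℂ) * (((-(m : ℤ) : ℤ) : ℂ) * n + k)) • (tvar ℂ k * tvar ℂ (-(-(m : ℤ)) * n - k) * f) =
      -∑ k ∈ idx n (m * n), psum k * psum (m * n - k) * f := by
    rw [← sum_neg_distrib]
    symm
    refine sum_bij (fun k _ => (k : ℤ)) ?_ ?_ ?_ ?_
    · intro k hk
      rw [mem_idx] at hk
      have := pos_of_not_dvd hk.2
      rw [mem_filter, mem_Icc, neg_neg, Int.natCast_dvd_natCast]
      have : (k : ℤ) < ((m * n : ℕ) : ℤ) := by exact_mod_cast hk.1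
      push_cast at this
      exact ⟨by omega, hk.2⟩
    · intro a _ b _ h; exact_mod_cast h
    · intro b hb
      rw [mem_filter, mem_Icc, neg_neg] at hb
      obtain ⟨⟨h1, h2⟩, h3⟩ := hb
      lift b to ℕ using by omega
      refine ⟨b, mem_idx.mpr ⟨?_, by exact_mod_cast h3⟩, rfl⟩
      zify; omega
    · intro k hk
      rw [mem_idx] at hk
      rw [psum, psum, Nat.cast_sub hk.1.le, neg_neg, show (((m * n - k : ℕ) : ℤ)) = (m : ℤ) * n - k by
        rw [Nat.cast_sub hk.1.le]; push_cast; rfl]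
      simp only [MvPolynomial.smul_eq_C_mul, map_mul, map_add, map_sub, map_neg, Int.cast_neg,
        Int.cast_natCast, Nat.cast_mul]
      ring
  rw [virasoro, h2, h3, if_neg (by omega)]
  simp only [virasoroDiff_term, filter_empty, sum_empty, smul_zero, add_zero, zero_smul, smul_neg,
    sub_neg_eq_add]
  rfl

/-- The operator `L_{-m}^{(n)}` as a linear map. -/
def virL (n m : ℕ) : Lam ℂ →ₗ[ℂ] Lam ℂ where
  toFun f := virasoroDiff n m f +
      (1 / 2 : ℂ) • ∑ k ∈ idx n (m * n), psum k * psum (m * n - k) * f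
  map_add' f g := by
    have : virasoroDiff n m (f + g) = virasoroDiff n m f + virasoroDiff n m g := by
      rw [virasoroDiff, virasoroDiff, virasoroDiff,
        ← finsum_add_distrib (finite_virasoroDiff n m f) (finite_virasoroDiff n m g)]
      refine finsum_congr fun k => ?_
      split_ifs <;> simp [mul_add]
    rw [this]
    simp only [mul_add, sum_add_distrib, smul_add]
    abel
  map_smul' x f := by
    have : virasoroDiff n m (x • f) = x • virasoroDiff n m f := by
      rw [virasoroDiff, virasoroDiff, smul_finsum]
      refine finsum_congr fun k => ?_
      split_ifs <;> simp
    rw [this]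
    simp only [mul_smul_comm, ← Finset.smul_sum, smul_add, RingHom.id_apply, smul_comm x]

theorem virL_apply (n m : ℕ) (f : Lam ℂ) : virL n m f = virasoroDiff n m f +
    (1 / 2 : ℂ) • ∑ k ∈ idx n (m * n), psum k * psum (m * n - k) * f := rfl

theorem virL_one (n m : ℕ) :
    virL n m 1 = (1 / 2 : ℂ) • ∑ k ∈ idx n (m * n), psum k * psum (m * n - k) := by
  have : virasoroDiff n m 1 = 0 := by
    refine finsum_eq_zero_of_forall_eq_zero fun k => ?_
    rw [← MvPolynomial.C_1, dt_C, mul_zero, ite_self]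
  rw [virL_apply, this, zero_add]
  simp only [mul_one]

theorem virL_X_mul {n m : ℕ} {j : ℕ+} (hj : ¬ n ∣ (j : ℕ)) (f : Lam ℂ) :
    virL n m (MvPolynomial.X j * f) =
      MvPolynomial.X j * virL n m f + psum (j + m * n) * f := by
  have hd : virasoroDiff n m (MvPolynomial.X j * f) =
      MvPolynomial.X j * virasoroDiff n m f + psum (j + m * n) * f := by
    have h1 : ∀ k : ℕ, (if ¬ n ∣ k then psum k * dt ℂ (k - (m * n : ℕ)) (MvPolynomial.X j * f)
        else 0) = MvPolynomial.X j * (if ¬ n ∣ k then psum k * dt ℂ (k - (m * n : ℕ)) f else 0) +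
          if k = j + m * n then psum (j + m * n) * f else 0 := by
      intro k
      have hk : ((k : ℤ) - (m * n : ℕ) = (j : ℕ)) ↔ k = j + m * n := by omega
      rw [dt_X_mul_int, if_congr hk rfl rfl]
      by_cases h : k = j + m * n
      · have : ¬ n ∣ k := by rwa [h, Nat.dvd_add_left (dvd_mul_left n m)]
        rw [if_pos h, if_pos h, if_pos this, if_pos this, h]
        ring
      · rw [if_neg h, if_neg h]
        split_ifs <;> ring
    rw [virasoroDiff, finsum_congr h1, finsum_add_distrib, ← mul_finsum,
      finsum_eq_single (fun k : ℕ => if k = j + m * n then psum (j + m * n) * f else 0)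
        (j + m * n : ℕ), if_pos rfl]
    · rfl
    · intro k hk; rw [if_neg hk]
    · refine (finite_virasoroDiff n m f).subset fun k hk => ?_
      rw [Function.mem_support] at hk ⊢
      exact fun h => hk (by rw [h, mul_zero])
    · refine (Set.finite_singleton (j + m * n : ℕ)).subset fun k hk => ?_
      by_contra h
      exact hk (if_neg h)
  rw [virL_apply, hd, virL_apply, mul_add, mul_smul_comm, mul_sum]
  simp only [mul_left_comm _ (MvPolynomial.X j)]
  abel

theorem virL_psum_mul {n m : ℕ} {j : ℕ} (hj : ¬ n ∣ j) (f : Lam ℂ) :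
    virL n m (psum j * f) = psum j * virL n m f + (j : ℂ) • (psum (j + m * n) * f) := by
  have h0 := pos_of_not_dvd hj
  lift j to ℕ+ using h0
  rw [psum_natCast, smul_mul_assoc, map_smul, virL_X_mul hj, smul_add, smul_mul_assoc]

variable {n : ℕ} {ξ : ℂ}

/-- Newton's recursion for `q_M`, `M = a + m n`, in terms of the action of `L_{-m}` on `q_a`. The
terms with `n ∣ k` vanish since `ξ ^ n = 1`. -/
theorem virasoroDiff_qpos (hξ : IsPrimitiveRoot ξ n) (m : ℕ) (a : ℤ) :
    ((a + (m * n : ℕ) : ℤ) : ℂ) • qpos ξ (a + (m * n : ℕ)) = virasoroDiff n m (qpos ξ a) +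
      ∑ k ∈ idx n (m * n), (1 - ξ ^ k) • (psum k * qpos ξ (a + (m * n : ℕ) - k)) := by
  have h1 : ∀ k : ℕ, (1 - ξ ^ k) • (psum k * qpos ξ (a + (m * n : ℕ) - k)) =
      (if ¬ n ∣ k then psum k * dt ℂ (k - (m * n : ℕ)) (qpos ξ a) else 0) +
      if k ∈ idx n (m * n) then (1 - ξ ^ k) • (psum k * qpos ξ (a + (m * n : ℕ) - k)) else 0 := by
    intro k
    by_cases hk : n ∣ k
    · rw [if_neg (not_not.mpr hk), if_neg fun h => (mem_idx.mp h).2 hk,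
        (hξ.pow_eq_one_iff_dvd k).mpr hk, sub_self, zero_smul, add_zero]
    · rw [if_pos hk]
      rcases lt_or_ge k (m * n) with hlt | hge
      · rw [if_pos (mem_idx.mpr ⟨hlt, hk⟩), dt_of_nonpos (by omega), LinearMap.zero_apply, mul_zero,
          zero_add]
      · have hne : k ≠ m * n := fun h => hk (h ▸ dvd_mul_left n m)
        obtain ⟨r, rfl⟩ := Nat.exists_eq_add_of_le hge
        have hr : ξ ^ (m * n + r) = ξ ^ r := by
          rw [pow_add, (hξ.pow_eq_one_iff_dvd _).mpr (dvd_mul_left n m), one_mul]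
        rw [if_neg fun h => by have := (mem_idx.mp h).1; omega, add_zero, hr,
          show ((m * n + r : ℕ) : ℤ) - (m * n : ℕ) = r by push_cast; ring, dt_qpos ξ (by omega),
          mul_smul_comm, show a + (m * n : ℕ) - (m * n + r : ℕ) = a - r by push_cast; ring]
  rw [newton_qpos, finsum_congr h1, finsum_add_distrib (finite_virasoroDiff n m _)]
  · congr 1
    rw [finsum_eq_sum_of_support_subset (s := idx n (m * n))]
    · exact sum_congr rfl fun k hk => if_pos hk
    · intro k hk
      by_contra h
      exact hk (if_neg h)
  · refine (idx n (m * n)).finite_toSet.subset fun k hk => ?_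
    by_contra h
    exact hk (if_neg h)

/-- The defect in the commutation relation of `L_{-m}` with `B_a`. -/
def defect (n m : ℕ) (ξ : ℂ) (a : ℤ) : Lam ℂ →ₗ[ℂ] Lam ℂ :=
  virL n m ∘ₗ bop ξ a - bop ξ a ∘ₗ virL n m
    - ((a : ℂ) + (m : ℂ) * ((n : ℂ) - 1) / 2) • bop ξ (a + (m * n : ℕ))
    - ∑ k ∈ idx n (m * n),
        ξ ^ k • (bop ξ (a + (m * n : ℕ) - k) ∘ₗ LinearMap.mulLeft ℂ (psum k))

theorem defect_apply (n m : ℕ) (ξ : ℂ) (a : ℤ) (f : Lam ℂ) :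
    defect n m ξ a f = virL n m (bop ξ a f) - bop ξ a (virL n m f)
      - ((a : ℂ) + (m : ℂ) * ((n : ℂ) - 1) / 2) • bop ξ (a + (m * n : ℕ)) f
      - ∑ k ∈ idx n (m * n), ξ ^ k • bop ξ (a + (m * n : ℕ) - k) (psum k * f) := by
  simp [defect, LinearMap.sum_apply]

theorem defect_one (hn : 2 ≤ n) (hξ : IsPrimitiveRoot ξ n) (m : ℕ) (a : ℤ) :
    defect n m ξ a 1 = 0 := by
  set M : ℤ := a + (m * n : ℕ) with hM
  have e1 : bop ξ a (virL n m 1) = (1 / 2 : ℂ) • ∑ k ∈ idx n (m * n),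
        psum k * psum (m * n - k) * qpos ξ a
      - ∑ k ∈ idx n (m * n), psum k * qpos ξ (M - k)
      + ((m : ℂ) * ((n : ℂ) - 1) / 2) • qpos ξ M := by
    have t : ∀ k ∈ idx n (m * n), bop ξ a (psum k * psum (m * n - k)) =
        psum k * psum (m * n - k) * qpos ξ a - psum k * qpos ξ (M - k)
          - psum (m * n - k) * qpos ξ (M - (m * n - k : ℕ)) + qpos ξ M := by
      intro k hk
      rw [mem_idx] at hk
      have hk0 := pos_of_not_dvd hk.2
      have hc : ((m * n - k : ℕ) : ℤ) = (m * n : ℕ) - k := Nat.cast_sub hk.1.le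
      rw [bop_psum_mul ξ a hk0, ← mul_one (psum (m * n - k)), bop_psum_mul ξ a (by omega),
        bop_psum_mul ξ _ (by omega), bop_one, bop_one, bop_one, bop_one, hc,
        show a + ((m * n : ℕ) - (k : ℤ)) = M - k by rw [hM]; ring,
        show M - ((m * n : ℕ) - (k : ℤ)) = a + k by rw [hM]; ring,
        show a + (k : ℤ) + ((m * n : ℕ) - (k : ℤ)) = M by rw [hM]; ring]
      ring
    rw [virL_one, map_smul, map_sum, sum_congr rfl t, sum_add_distrib, sum_sub_distrib,
      sum_sub_distrib, sum_const, ← Nat.cast_smul_eq_nsmul ℂ, card_idx (by omega),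
      sum_idx_reflect n m fun _ k' => psum k' * qpos ξ (M - (k' : ℕ))]
    module
  have e2 : ∑ k ∈ idx n (m * n), ξ ^ k • bop ξ (M - k) (psum k * 1) =
      ∑ k ∈ idx n (m * n), ξ ^ k • (psum k * qpos ξ (M - k)) + (m : ℂ) • qpos ξ M := by
    have t : ∀ k ∈ idx n (m * n), ξ ^ k • bop ξ (M - k) (psum k * 1) =
        ξ ^ k • (psum k * qpos ξ (M - k)) - ξ ^ k • qpos ξ M := by
      intro k hk
      rw [bop_psum_mul ξ _ (pos_of_not_dvd (mem_idx.mp hk).2), bop_one, bop_one, sub_add_cancel,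
        smul_sub]
    rw [sum_congr rfl t, sum_sub_distrib, ← Finset.sum_smul, sum_pow_idx hn hξ, neg_smul,
      sub_neg_eq_add]
  have e3 := virasoroDiff_qpos hξ m a
  rw [← hM] at e3
  simp only [sub_smul, one_smul, sum_sub_distrib] at e3
  rw [defect_apply, ← hM, e1, e2, bop_one, bop_one, virL_apply]
  have e4 : (M : ℂ) = a + m * n := by rw [hM]; push_cast; ring
  rw [e4] at e3
  linear_combination (norm := module) (-1 : ℂ) • e3

theorem defect_psum_mul (n m : ℕ) (ξ : ℂ) (a : ℤ) {j : ℕ} (hj : ¬ n ∣ j) (f : Lam ℂ) :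
    defect n m ξ a (psum j * f) = psum j * defect n m ξ a f - defect n m ξ (a + j) f := by
  have hj0 := pos_of_not_dvd hj
  have t : ∀ k : ℕ, ξ ^ k • bop ξ (a + (m * n : ℕ) - k) (psum k * (psum j * f)) =
      psum j * (ξ ^ k • bop ξ (a + (m * n : ℕ) - k) (psum k * f)) -
        ξ ^ k • bop ξ (a + j + (m * n : ℕ) - k) (psum k * f) := by
    intro k
    rw [mul_left_comm, bop_psum_mul ξ _ hj0, smul_sub, mul_smul_comm,
      show a + (m * n : ℕ) - (k : ℤ) + j = a + j + (m * n : ℕ) - k by ring]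
  simp only [defect_apply, t, sum_sub_distrib, ← mul_sum]
  rw [bop_psum_mul ξ a hj0, map_sub, virL_psum_mul hj, virL_psum_mul hj, map_add, map_smul,
    bop_psum_mul ξ a hj0, bop_psum_mul ξ a (by omega), bop_psum_mul ξ _ hj0,
    show a + (m * n : ℕ) + (j : ℤ) = a + j + (m * n : ℕ) by ring,
    show a + ((j + m * n : ℕ) : ℤ) = a + j + (m * n : ℕ) by push_cast; ring]
  simp only [MvPolynomial.smul_eq_C_mul, map_add, Int.cast_add, Int.cast_natCast]
  ring

end Virasoro

section Subring

variable {n : ℕ} {ξ : ℂ}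

/-- The polynomials in the variables `t_k` with `n ∤ k`. -/
def reduced (n : ℕ) : Subalgebra ℂ (Lam ℂ) :=
  (MvPolynomial.rename ((↑) : {k : ℕ+ // ¬ n ∣ (k : ℕ)} → ℕ+)).range

theorem reduced_induction {P : Lam ℂ → Prop} (one : P 1) (smul : ∀ (x : ℂ) f, P f → P (x • f))
    (add : ∀ f g, P f → P g → P (f + g))
    (mul : ∀ (j : ℕ) f, ¬ n ∣ j → P f → P (psum j * f)) {f : Lam ℂ} (hf : f ∈ reduced n) : P f := by
  obtain ⟨g, rfl⟩ := hf
  change P (MvPolynomial.rename _ g)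
  induction g using MvPolynomial.induction_on with
  | C x =>
    rw [MvPolynomial.rename_C, ← mul_one (MvPolynomial.C x), ← MvPolynomial.smul_eq_C_mul]
    exact smul x 1 one
  | add f g hf hg => rw [map_add]; exact add _ _ hf hg
  | mul_X f k hf =>
    have hk : (((k : ℕ+) : ℕ) : ℂ) ≠ 0 := by exact_mod_cast k.1.pos.ne'
    have := smul ((((k : ℕ+) : ℕ) : ℂ)⁻¹) _ (mul k _ k.2 hf)
    rwa [psum_natCast, smul_mul_assoc, smul_smul, inv_mul_cancel₀ hk, one_smul, mul_comm,
      ← MvPolynomial.rename_X, ← map_mul] at this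

theorem psum_mem_reduced {j : ℕ} (hj : ¬ n ∣ j) : psum j ∈ reduced n := by
  have h0 := pos_of_not_dvd hj
  lift j to ℕ+ using h0
  rw [psum_natCast]
  exact (reduced n).smul_mem ⟨MvPolynomial.X ⟨j, hj⟩, MvPolynomial.rename_X _ _⟩ _

theorem qpos_mem_reduced (hξ : IsPrimitiveRoot ξ n) (a : ℤ) : qpos ξ a ∈ reduced n := by
  rcases lt_or_ge a 0 with h | h
  · rw [qpos_of_neg ξ h]; exact zero_mem _
  lift a to ℕ using h
  induction a using Nat.strong_induction_on with
  | _ a ih =>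
    rcases Nat.eq_zero_or_pos a with rfl | ha
    · rw [qpos, zcoeff_natCast, coeff_zero_expX]; exact one_mem _
    · have ha' : (((a : ℕ) : ℤ) : ℂ) ≠ 0 := by exact_mod_cast ha.ne'
      rw [← inv_smul_smul₀ ha' (qpos ξ a), newton_qpos]
      refine (reduced n).smul_mem ?_ _
      refine finsum_induction (fun g => g ∈ reduced n) (zero_mem _) (fun _ _ => add_mem) fun k => ?_
      by_cases hk : n ∣ k
      · rw [(hξ.pow_eq_one_iff_dvd k).mpr hk, sub_self, zero_smul]; exact zero_mem _
      · have hk0 := pos_of_not_dvd hk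
        refine (reduced n).smul_mem (mul_mem (psum_mem_reduced hk) ?_) _
        rcases lt_or_ge a k with hlt | hge
        · rw [qpos_of_neg ξ (by omega)]; exact zero_mem _
        · rw [← Nat.cast_sub hge]; exact ih _ (by omega)

theorem bop_mem_reduced (hξ : IsPrimitiveRoot ξ n) (a : ℤ) {f : Lam ℂ} (hf : f ∈ reduced n) :
    bop ξ a f ∈ reduced n := by
  refine reduced_induction (P := fun f => ∀ a, bop ξ a f ∈ reduced n) ?_ ?_ ?_ ?_ hf a
  · intro a; rw [bop_one]; exact qpos_mem_reduced hξ a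
  · intro x f h a; rw [map_smul]; exact (reduced n).smul_mem (h a) x
  · intro f g hf hg a; rw [map_add]; exact add_mem (hf a) (hg a)
  · intro j f hj h a
    rw [bop_psum_mul ξ a (pos_of_not_dvd hj)]
    exact sub_mem (mul_mem (psum_mem_reduced hj) (h a)) (h _)

/-- The commutation relation of `L_{-m}` with `B_a` on the polynomials in the `t_k`, `n ∤ k`. As both
sides have the same commutators with the multiplications by the `p_k`, it follows from the value
at `1`. -/
theorem virL_bop (hn : 2 ≤ n) (hξ : IsPrimitiveRoot ξ n) (m : ℕ) (a : ℤ) {f : Lam ℂ}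
    (hf : f ∈ reduced n) :
    virL n m (bop ξ a f) = bop ξ a (virL n m f)
      + ((a : ℂ) + (m : ℂ) * ((n : ℂ) - 1) / 2) • bop ξ (a + (m * n : ℕ)) f
      + ∑ k ∈ idx n (m * n), ξ ^ k • bop ξ (a + (m * n : ℕ) - k) (psum k * f) := by
  have h : defect n m ξ a f = 0 := by
    refine reduced_induction (P := fun f => ∀ a, defect n m ξ a f = 0) ?_ ?_ ?_ ?_ hf a
    · exact defect_one hn hξ m
    · intro x f h a; rw [map_smul, h, smul_zero]
    · intro f g hf hg a; rw [map_add, hf, hg, add_zero]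
    · intro j f hj h a; rw [defect_psum_mul n m ξ a hj, h, h, mul_zero, sub_zero]
  rw [defect_apply, sub_eq_zero, sub_eq_iff_eq_add, sub_eq_iff_eq_add] at h
  rw [h]
  abel

end Subring

/-! ### Products of the operators `B` -/

section Vectors

/-- `B_{λ_1} ⋯ B_{λ_l} f`. -/
def bvec (ξ : ℂ) {l : ℕ} (lam : Fin l → ℤ) (f : Lam ℂ) : Lam ℂ :=
  (List.ofFn lam).foldr (fun a g => bop ξ a g) f

variable {ξ : ℂ} {l : ℕ}

theorem bvec_succ (lam : Fin (l + 1) → ℤ) (f : Lam ℂ) :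
    bvec ξ lam f = bop ξ (lam 0) (bvec ξ (Fin.tail lam) f) := by
  rw [bvec, List.ofFn_succ]; rfl

theorem bvec_zero (lam : Fin 0 → ℤ) (f : Lam ℂ) : bvec ξ lam f = f := by
  rw [bvec, List.ofFn_zero]; rfl

theorem Q_eq_bvec (lam : Fin l → ℤ) : Q ξ lam = bvec ξ lam 1 := Q_eq_qList ξ lam

theorem bvec_append {l' : ℕ} (lam : Fin l → ℤ) (v : Fin l' → ℤ) (f : Lam ℂ) :
    bvec ξ (Fin.append lam v) f = bvec ξ lam (bvec ξ v f) := by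
  rw [bvec, bvec, bvec, List.ofFn_fin_append, List.foldr_append]

theorem Q_append {l' : ℕ} (lam : Fin l → ℤ) (v : Fin l' → ℤ) :
    Q ξ (Fin.append lam v) = bvec ξ lam (Q ξ v) := by
  rw [Q_eq_bvec, Q_eq_bvec, bvec_append]

theorem bvec_add (lam : Fin l → ℤ) (f g : Lam ℂ) :
    bvec ξ lam (f + g) = bvec ξ lam f + bvec ξ lam g := by
  induction l with
  | zero => simp only [bvec_zero]
  | succ l ih => simp only [bvec_succ, ih, map_add]

theorem bvec_smul (lam : Fin l → ℤ) (x : ℂ) (f : Lam ℂ) :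
    bvec ξ lam (x • f) = x • bvec ξ lam f := by
  induction l with
  | zero => simp only [bvec_zero]
  | succ l ih => simp only [bvec_succ, ih, map_smul]

theorem bvec_sum {ι : Type*} (s : Finset ι) (lam : Fin l → ℤ) (f : ι → Lam ℂ) :
    bvec ξ lam (∑ i ∈ s, f i) = ∑ i ∈ s, bvec ξ lam (f i) := by
  induction l with
  | zero => simp only [bvec_zero]
  | succ l ih => simp only [bvec_succ, ih, map_sum]

theorem bvec_mem_reduced {n : ℕ} (hξ : IsPrimitiveRoot ξ n) (lam : Fin l → ℤ) {f : Lam ℂ}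
    (hf : f ∈ reduced n) : bvec ξ lam f ∈ reduced n := by
  induction l with
  | zero => rwa [bvec_zero]
  | succ l ih => rw [bvec_succ]; exact bop_mem_reduced hξ _ (ih _)

theorem tail_add_single_zero (lam : Fin (l + 1) → ℤ) (x : ℤ) :
    Fin.tail (lam + Pi.single 0 x) = Fin.tail lam := by
  funext i
  simp [Fin.tail]

theorem tail_add_single_succ (lam : Fin (l + 1) → ℤ) (i : Fin l) (x : ℤ) :
    Fin.tail (lam + Pi.single i.succ x) = Fin.tail lam + Pi.single i x := by
  funext j
  simp [Fin.tail, Pi.single_apply]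

theorem bvec_add_single_zero (lam : Fin (l + 1) → ℤ) (x : ℤ) (f : Lam ℂ) :
    bvec ξ (lam + Pi.single 0 x) f = bop ξ (lam 0 + x) (bvec ξ (Fin.tail lam) f) := by
  rw [bvec_succ, tail_add_single_zero]
  simp

theorem bvec_add_single_succ (lam : Fin (l + 1) → ℤ) (i : Fin l) (x : ℤ) (f : Lam ℂ) :
    bvec ξ (lam + Pi.single i.succ x) f =
      bop ξ (lam 0) (bvec ξ (Fin.tail lam + Pi.single i x) f) := by
  rw [bvec_succ, tail_add_single_succ]
  simp [(Fin.succ_ne_zero i).symm]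

theorem psum_mul_bvec {k : ℕ} (hk : 0 < k) (lam : Fin l → ℤ) (f : Lam ℂ) :
    psum k * bvec ξ lam f =
      ∑ i, bvec ξ (lam + Pi.single i (k : ℤ)) f + bvec ξ lam (psum k * f) := by
  induction l with
  | zero => simp [bvec_zero]
  | succ l ih =>
    rw [Fin.sum_univ_succ, bvec_add_single_zero]
    simp only [bvec_add_single_succ]
    rw [bvec_succ, bvec_succ, add_assoc, ← map_sum, ← map_add, ← ih, bop_psum_mul ξ _ hk]
    abel

theorem sum_filter_lt_succ {M : Type*} [AddCommMonoid M] (F : Fin (l + 1) → Fin (l + 1) → M) :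
    ∑ p ∈ (univ : Finset (Fin (l + 1) × Fin (l + 1))).filter (fun p => p.2 < p.1), F p.1 p.2 =
      ∑ i : Fin l, F i.succ 0 +
        ∑ p ∈ (univ : Finset (Fin l × Fin l)).filter (fun p => p.2 < p.1),
          F p.1.succ p.2.succ := by
  rw [sum_filter, sum_filter, ← univ_product_univ, ← univ_product_univ, sum_product, sum_product,
    Fin.sum_univ_succ]
  simp only [Fin.sum_univ_succ, Fin.succ_pos, if_true, Fin.succ_lt_succ_iff, Fin.not_lt_zero,
    if_false, sum_const_zero, zero_add, sum_add_distrib]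

/-- The action of `L_{-m}` moved through a product of operators `B`. -/
theorem virL_bvec {n : ℕ} (hn : 2 ≤ n) (hξ : IsPrimitiveRoot ξ n) (m : ℕ) (lam : Fin l → ℤ)
    {f : Lam ℂ} (hf : f ∈ reduced n) :
    virL n m (bvec ξ lam f) =
      (∑ i : Fin l, ((lam i : ℂ) + (m : ℂ) * ((n : ℂ) - 1) / 2) •
        bvec ξ (lam + Pi.single i ((m : ℤ) * n)) f)
      + (∑ k ∈ idx n (m * n),
          ∑ p ∈ (univ : Finset (Fin l × Fin l)).filter (fun p => p.2 < p.1), ξ ^ k •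
            bvec ξ (lam + Pi.single p.1 (k : ℤ) + Pi.single p.2 ((m : ℤ) * n - k)) f)
      + (∑ i : Fin l, ∑ k ∈ idx n (m * n), ξ ^ k •
          bvec ξ (lam + Pi.single i ((m : ℤ) * n - k)) (psum k * f))
      + bvec ξ lam (virL n m f) := by
  induction l with
  | zero => simp [bvec_zero]
  | succ l ih =>
    have hcast : ((m * n : ℕ) : ℤ) = (m : ℤ) * n := by push_cast; ring
    have hpair : ∀ k ∈ idx n (m * n),
        (∑ p ∈ (univ : Finset (Fin (l + 1) × Fin (l + 1))).filter (fun p => p.2 < p.1), ξ ^ k •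
          bvec ξ (lam + Pi.single p.1 (k : ℤ) + Pi.single p.2 ((m : ℤ) * n - k)) f) +
        ξ ^ k • bvec ξ (lam + Pi.single 0 ((m : ℤ) * n - k)) (psum k * f) =
        ξ ^ k • bop ξ (lam 0 + (m * n : ℕ) - k) (psum k * bvec ξ (Fin.tail lam) f) +
        bop ξ (lam 0) (∑ p ∈ (univ : Finset (Fin l × Fin l)).filter (fun p => p.2 < p.1), ξ ^ k •
          bvec ξ (Fin.tail lam + Pi.single p.1 (k : ℤ) + Pi.single p.2 ((m : ℤ) * n - k)) f) := by
      intro k hk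
      have hk0 := pos_of_not_dvd (mem_idx.mp hk).2
      have hs := sum_filter_lt_succ (fun i j : Fin (l + 1) => ξ ^ k •
        bvec ξ (lam + Pi.single i (k : ℤ) + Pi.single j ((m : ℤ) * n - k)) f)
      rw [hs, psum_mul_bvec hk0, map_add, smul_add, map_sum, map_sum, Finset.smul_sum, hcast,
        bvec_add_single_zero, ← add_sub_assoc]
      have t1 : ∀ i : Fin l, bvec ξ (lam + Pi.single i.succ (k : ℤ) +
          Pi.single 0 ((m : ℤ) * n - k)) f = bop ξ (lam 0 + (m : ℤ) * n - k)
            (bvec ξ (Fin.tail lam + Pi.single i (k : ℤ)) f) := by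
        intro i
        rw [bvec_add_single_zero, tail_add_single_succ]
        simp [(Fin.succ_ne_zero i).symm, add_sub_assoc]
      have t2 : ∀ i j : Fin l, bvec ξ (lam + Pi.single i.succ (k : ℤ) +
          Pi.single j.succ ((m : ℤ) * n - k)) f = bop ξ (lam 0)
            (bvec ξ (Fin.tail lam + Pi.single i (k : ℤ) + Pi.single j ((m : ℤ) * n - k)) f) := by
        intro i j
        rw [bvec_add_single_succ, tail_add_single_succ]
        simp [(Fin.succ_ne_zero i).symm]
      simp only [t1, t2, map_smul]
      abel
    have hs := Fin.sum_univ_succ (fun i : Fin (l + 1) => ∑ k ∈ idx n (m * n), ξ ^ k •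
      bvec ξ (lam + Pi.single i ((m : ℤ) * n - k)) (psum k * f))
    rw [bvec_succ, virL_bop hn hξ m _ (bvec_mem_reduced hξ _ hf), ih, map_add, map_add, map_add,
      Fin.sum_univ_succ, hs, bvec_succ lam (virL n m f)]
    have h := sum_congr rfl hpair
    rw [sum_add_distrib, sum_add_distrib, ← map_sum] at h
    simp only [bvec_add_single_succ] at h ⊢
    rw [bvec_add_single_zero, hcast] at *
    simp only [map_sum, map_smul] at h ⊢
    linear_combination (norm := skip) -h
    simp only [Fin.tail]
    abel

end Vectors

end HallLittlewood

end

open HallLittlewood in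
theorem theorem1p2 (n m l : ℕ) (hn : 2 ≤ n) (hm : 1 ≤ m) (ξ : ℂ) (hξ : IsPrimitiveRoot ξ n)
    (lam : Fin l → ℤ) :
    HallLittlewood.virasoro n (-(m : ℤ)) (HallLittlewood.Q ξ lam) =
      (∑ i : Fin l, ((lam i : ℂ) + (m : ℂ) * ((n : ℂ) - 1) / 2) •
          HallLittlewood.Q ξ (lam + Pi.single i ((m : ℤ) * n)))
      + (∑ k ∈ HallLittlewood.idx n (m * n),
          ∑ p ∈ (Finset.univ : Finset (Fin l × Fin l)).filter (fun p => p.2 < p.1),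
            ξ ^ k • HallLittlewood.Q ξ
              (lam + Pi.single p.1 (k : ℤ) + Pi.single p.2 ((m : ℤ) * n - k)))
      + (∑ i : Fin l, ∑ k ∈ HallLittlewood.idx n (m * n), ξ ^ k •
          ∑ μ : Nat.Partition k, HallLittlewood.c μ ξ • HallLittlewood.Q ξ
            (Fin.append (lam + Pi.single i ((m : ℤ) * n - k)) (HallLittlewood.vec μ)))
      + (1 / 2 : ℂ) • ∑ k ∈ HallLittlewood.idx n (m * n),
          ((∑ μ : Nat.Partition k, ∑ j : Fin (HallLittlewood.len μ),
              HallLittlewood.c μ ξ • HallLittlewood.Q ξ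
                (Fin.append lam (HallLittlewood.vec μ + Pi.single j ((m : ℤ) * n - k))))
            + ∑ μ : Nat.Partition k, ∑ ν : Nat.Partition (m * n - k),
                (HallLittlewood.c μ ξ * HallLittlewood.c ν ξ) • HallLittlewood.Q ξ
                  (Fin.append (Fin.append lam (HallLittlewood.vec μ))
                    (HallLittlewood.vec ν))) := by
  have hpsum : ∀ k : ℕ, ¬ n ∣ k →
      psum k = ∑ μ : Nat.Partition k, c μ ξ • Q ξ (vec μ) := fun k hk => by
    rw [psum, smul_tvar_eq_sum_qList hξ (by omega) hk]
    simp only [Q_eq_qList, ofFn_vec]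
  rw [virasoro_neg n hm, ← virL_apply, Q_eq_bvec, virL_bvec hn hξ m lam (one_mem _), virL_one]
  refine congrArg₂ (· + ·) (congrArg₂ (· + ·) ?_ ?_) ?_
  · simp only [Q_eq_bvec]
  · refine Finset.sum_congr rfl fun i _ => Finset.sum_congr rfl fun k hk => ?_
    rw [mul_one, hpsum k (mem_idx.mp hk).2, bvec_sum]
    simp only [bvec_smul, Q_append]
  · rw [bvec_smul, bvec_sum]
    refine congrArg ((1 / 2 : ℂ) • ·) (Finset.sum_congr rfl fun k hk => ?_)
    obtain ⟨hlt, hk⟩ := mem_idx.mp hk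
    have hk' : ¬ n ∣ m * n - k := fun hd =>
      hk ((Nat.dvd_sub_iff_right hlt.le (dvd_mul_left n m)).mp hd)
    have hcast : ((m * n - k : ℕ) : ℤ) = (m : ℤ) * n - k := by
      rw [Nat.cast_sub hlt.le]; push_cast; ring
    have key : psum k * psum (m * n - k) =
        ∑ μ : Nat.Partition k, ∑ j : Fin (len μ),
          c μ ξ • Q ξ (vec μ + Pi.single j ((m : ℤ) * n - k)) +
        ∑ μ : Nat.Partition k, ∑ ν : Nat.Partition (m * n - k),
          (c μ ξ * c ν ξ) • bvec ξ (vec μ) (Q ξ (vec ν)) := by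
      rw [mul_comm, hpsum k hk, Finset.mul_sum, ← Finset.sum_add_distrib]
      refine Finset.sum_congr rfl fun μ _ => ?_
      rw [mul_smul_comm, Q_eq_bvec, psum_mul_bvec (pos_of_not_dvd hk'), mul_one, hpsum _ hk',
        hcast, bvec_sum, smul_add, Finset.smul_sum, Finset.smul_sum]
      simp only [Q_eq_bvec, bvec_smul, smul_smul]
    rw [key, bvec_add]
    simp only [bvec_sum, bvec_smul, Q_append, bvec_append]
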